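/- Let $V$ be a three-dimensional real vector space. A (one-parametric continuous) contraction of a Lie algebra $\mathfrak g=(V,[\cdot,\cdot])$ to a Lie algebra $\mathfrak g_0=(V,[\cdot,\cdot]_0)$ is given by a continuous function $U\colon(0,1]\to GL(V)$ with $[x,y]_0=\lim_{\varepsilon\to+0}U_\varepsilon^{-1}[U_\varepsilon x,U_\varepsilon y]$ for all $x,y\in V$. It is proper if $\mathfrak g_0\not\cong\mathfrak g$, and nontrivial if $\mathfrak g_0$ is not Abelian. Contractions $\mathfrak g\to\mathfrak g_0$ and $\tilde{\mathfrak g}\to\tilde{\mathfrak g}_0$ are equivalent if $\mathfrak g\cong\tilde{\mathfrak g}$ and $\mathfrak g_0\cong\tilde{\mathfrak g}_0$. A contraction is a generalized In\"on\"u--Wigner contraction with powers $\alpha_1,\alpha_2,\alpha_3\in\mathbb Z$ if $U_\varepsilon=\hat W^{-1}\operatorname{diag}(\varepsilon^{\alpha_1},\varepsilon^{\alpha_2},\varepsilon^{\alpha_3})\check W$ with constant nonsingular matrices $\hat W,\check W$. It is a simple In\"on\"u--Wigner contraction if $U_\varepsilon=\hat W^{-1}\operatorname{diag}(1+\varepsilon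 v,\dots,1+\varepsilon v,\varepsilon,\dots,\varepsilon)\check W$ with constant nonsingular $\hat W,\check W$ and a constant $v\in\mathbb R$, where the number $s$ of entries $1+\varepsilon v$ is any number from $0$ to $3$; its associated subalgebra is the span of the first $s$ columns of $\hat W^{-1}$. Write the following algebras in a basis $e_1,e_2,e_3$, listing the nonzero commutators: $A_{2.1}\oplus A_1$: $[e_1,e_2]=e_1$; $A_{3.1}$: $[e_2,e_3]=e_1$; $A_{3.2}$: $[e_1,e_3]=e_1$, $[e_2,e_3]=e_1+e_2$; $A_{3.3}$: $[e_1,e_3]=e_1$, $[e_2,e_3]=e_2$; $A_{3.4}^a$ ($-1\le a<1$, $a\ne0$): $[e_1,e_3]=e_1$, $[e_2,e_3]=ae_2$; $A_{3.5}^b$ ($b\ge0$): $[e_1,e_3]=be_1-e_2$, $[e_2,e_3]=e_1+be_2$; $sl(2,\mathbb R)$: $[e_1,e_2]=e_1$, $[e_2,e_3]=e_3$, $[e_1,e_3]=2e_2$; $so(3)$: $[e_1,e_2]=e_3$, $[e_2,e_3]=e_1$, $[e_3,e_1]=e_2$. Put $W(k_1,k_2,k_3)=\operatorname{diag}(\varepsilon^{k_1},\varepsilon^{k_2},\varepsilon^{k_3})$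 and $$I_1=\begin{pmatrix}1&0&-1\\0&1&0\\0&0&1\end{pmatrix},\ I_2=\begin{pmatrix}1-a&1&0\\0&1&0\\0&0&1\end{pmatrix},\ I_3=\begin{pmatrix}0&1&0\\2&0&0\\0&0&1\end{pmatrix},\ I_4=\begin{pmatrix}1&0&0\\0&0&1\\0&-1&0\end{pmatrix},$$ $$I_5=\begin{pmatrix}0&0&\frac12\\0&1&0\\1&0&\frac12\end{pmatrix},\ I_6=\begin{pmatrix}1&0&0\\0&1&1\\0&0&1\end{pmatrix},\ I_7=\begin{pmatrix}-1&0&0\\0&1&0\\0&0&-1\end{pmatrix}.$$ Theorem. (1) Every contraction of a real three-dimensional Lie algebra is equivalent to a generalized In\"on\"u--Wigner contraction with nonnegative powers $\alpha_i$ of $\varepsilon$. (2) Every proper nontrivial contraction of a real three-dimensional Lie algebra is equivalent to one in the following list. Conversely, every entry of the list is a proper nontrivial contraction (with the displayed matrix as $U_\varepsilon$), and an entry displayed with a subalgebra $\langle\cdots\rangle$ is, for the first matrix displayed, a simple In\"on\"u--Wigner contraction with that associated subalgebra: - $A_{2.1}\oplus A_1\to A_{3.1}$: $I_1W(1,1,0)$,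 $\langle e_1-e_3\rangle$; - $A_{3.2}\to A_{3.1}$: $I_7W(1,0,1)$ or $W(2,1,1)$, $\langle e_2\rangle$; - $A_{3.2}\to A_{3.3}$: $I_6W(0,1,0)$ or $W(1,2,0)$, $\langle e_1,e_2+e_3\rangle$; - $A_{3.4}^a\to A_{3.1}$ ($-1\le a<1$, $a\ne0$): $I_2W(1,0,1)$, $\langle e_1+e_2\rangle$; - $A_{3.5}^b\to A_{3.1}$ ($b\ge0$): $W(1,0,1)$, $\langle e_2\rangle$; - $sl(2,\mathbb R)\to A_{3.1}$: $I_3W(1,1,0)$, $\langle e_3\rangle$; - $sl(2,\mathbb R)\to A_{3.4}^{-1}$: $I_4W(1,0,0)$, $\langle e_2,e_3\rangle$; - $sl(2,\mathbb R)\to A_{3.5}^0$: $I_5W(1,1,0)$, $\langle e_1+e_3\rangle$; - $so(3)\to A_{3.1}$: $W(2,1,1)$; - $so(3)\to A_{3.5}^0$: $W(1,1,0)$, $\langle e_3\rangle$. (3) A contraction $\mathfrak g\to\mathfrak g_0$ of a real three-dimensional Lie algebra is equivalent to no simple In\"on\"u--Wigner contraction if and only if $\mathfrak g\cong so(3)$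 and $\mathfrak g_0\cong A_{3.1}$. -/

import Mathlib

open Set Filter Topology

noncomputable section

/-- A Lie bracket on the real vector space `V`: a point of the variety of all Lie brackets on `V`. -/
structure LieBracket (V : Type*) [AddCommGroup V] [Module ℝ V] where
  /-- the bracket `[x, y]` as a bilinear map -/
  bracket : V →ₗ[ℝ] V →ₗ[ℝ] V
  bracket_self : ∀ x, bracket x x = 0
  leibniz : ∀ x y z,
    bracket x (bracket y z) = bracket (bracket x y) z + bracket y (bracket x z)

namespace LieBracket

/-- The Lie algebra `(V, μ)`: the vector space `V`, equipped with the Lie bracket `μ`. -/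
def Algebra {V : Type*} [AddCommGroup V] [Module ℝ V] (_μ : LieBracket V) : Type _ := V

instance {V : Type*} [AddCommGroup V] [Module ℝ V] (μ : LieBracket V) :
    AddCommGroup μ.Algebra := inferInstanceAs (AddCommGroup V)

instance {V : Type*} [AddCommGroup V] [Module ℝ V] (μ : LieBracket V) :
    Module ℝ μ.Algebra := inferInstanceAs (Module ℝ V)

instance {V : Type*} [AddCommGroup V] [Module ℝ V] (μ : LieBracket V) :
    LieRing μ.Algebra where
  bracket x y := (μ.bracket x y : V)
  add_lie x y z := LinearMap.map_add₂ μ.bracket x y z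
  lie_add x y z := (μ.bracket x).map_add y z
  lie_self x := μ.bracket_self x
  leibniz_lie x y z := μ.leibniz x y z

instance {V : Type*} [AddCommGroup V] [Module ℝ V] (μ : LieBracket V) :
    LieAlgebra ℝ μ.Algebra where
  lie_smul t x y := (μ.bracket x).map_smul t y

/-- The Lie algebras `(V, μ)` and `(W, ν)` are isomorphic. -/
def Isomorphic {V W : Type*} [AddCommGroup V] [Module ℝ V] [AddCommGroup W] [Module ℝ W]
    (μ : LieBracket V) (ν : LieBracket W) : Prop :=
  Nonempty (μ.Algebra ≃ₗ⁅ℝ⁆ ν.Algebra)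

end LieBracket

/-- A one-parametric continuous contraction on the space `V`: a Lie algebra `(V, source)`, a
continuous function `U : (0, 1] → GL(V)` (the values of `U` outside `(0, 1]` play no role), and the
Lie algebra `(V, target)` with `[x, y]_target = lim_{ε → +0} U_ε⁻¹ [U_ε x, U_ε y]_source`. -/
structure Contraction (V : Type*) [NormedAddCommGroup V] [NormedSpace ℝ V] where
  source : LieBracket V
  target : LieBracket V
  U : ℝ → (V ≃L[ℝ] V)
  continuousOn : ContinuousOn (fun ε => (U ε : V →L[ℝ] V)) (Ioc 0 1)
  tendsto : ∀ x y : V,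
    Tendsto (fun ε => (U ε).symm (source.bracket (U ε x) (U ε y))) (𝓝[>] 0)
      (𝓝 (target.bracket x y))

namespace Contraction

/-- The contraction is proper if the resulting algebra is not isomorphic to the initial one. -/
def IsProper {V : Type*} [NormedAddCommGroup V] [NormedSpace ℝ V] (C : Contraction V) : Prop :=
  ¬ C.source.Isomorphic C.target

/-- The contraction is nontrivial if the resulting algebra is not Abelian. -/
def IsNontrivial {V : Type*} [NormedAddCommGroup V] [NormedSpace ℝ V] (C : Contraction V) : Prop :=
  ¬ IsLieAbelian C.target.Algebra

/-- (Weak) equivalence of contractions: the initial algebras are isomorphic, and so are the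
resulting algebras. -/
def Equivalent {V W : Type*} [NormedAddCommGroup V] [NormedSpace ℝ V]
    [NormedAddCommGroup W] [NormedSpace ℝ W] (C : Contraction V) (D : Contraction W) : Prop :=
  C.source.Isomorphic D.source ∧ C.target.Isomorphic D.target

/-- `U_ε = Ŵ⁻¹ diag(d_1(ε), …, d_n(ε)) W̌` on `(0, 1]` for constant nonsingular `Ŵ` and `W̌`: these
are the operators that send `b` and `b'`, respectively, to the fixed basis of `V` in which matrices
are written. -/
def IsDiagonalized {V : Type*} [NormedAddCommGroup V] [NormedSpace ℝ V] (C : Contraction V)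
    {n : ℕ} (b b' : Module.Basis (Fin n) ℝ V) (d : ℝ → Fin n → ℝ) : Prop :=
  ∀ ε ∈ Ioc (0 : ℝ) 1, ∀ i, C.U ε (b' i) = d ε i • b i

/-- A generalized Inönü–Wigner contraction with the integer exponents `α`:
`U_ε = Ŵ⁻¹ diag(ε ^ α_1, …, ε ^ α_n) W̌`. -/
def IsGeneralizedIW {V : Type*} [NormedAddCommGroup V] [NormedSpace ℝ V] (C : Contraction V)
    {n : ℕ} (α : Fin n → ℤ) : Prop :=
  ∃ b b' : Module.Basis (Fin n) ℝ V, C.IsDiagonalized b b' (fun ε i => ε ^ α i)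

/-- A simple Inönü–Wigner contraction, with associated subspace `S` of the initial algebra:
`U_ε = Ŵ⁻¹ diag(1 + ε v, …, 1 + ε v, ε, …, ε) W̌`, where `S` is spanned by the vectors that
belong to the first block, whose size is `s` (the block may be empty or everything). Here `n` is
necessarily the dimension of `V`. -/
def IsSimpleIWAlong {V : Type*} [NormedAddCommGroup V] [NormedSpace ℝ V] (C : Contraction V)
    (S : Submodule ℝ V) : Prop :=
  ∃ (n s : ℕ) (v : ℝ) (b b' : Module.Basis (Fin n) ℝ V),
    C.IsDiagonalized b b' (fun ε i => if (i : ℕ) < s then 1 + ε * v else ε) ∧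
    S = Submodule.span ℝ {x | ∃ i : Fin n, (i : ℕ) < s ∧ x = b i}

/-- A simple Inönü–Wigner contraction. -/
def IsSimpleIW {V : Type*} [NormedAddCommGroup V] [NormedSpace ℝ V] (C : Contraction V) : Prop :=
  ∃ S : Submodule ℝ V, C.IsSimpleIWAlong S

end Contraction

/-- The space of coordinate vectors on which the canonical three-dimensional algebras live. -/
abbrev R3 : Type := Fin 3 → ℝ

/-- The skew bilinear map on `R3` with `[e₁, e₂] = p`, `[e₁, e₃] = q`, `[e₂, e₃] = r`. -/
def skew3 (p q r : R3) : R3 →ₗ[ℝ] R3 →ₗ[ℝ] R3 :=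
  LinearMap.mk₂ ℝ
    (fun x y => (x 0 * y 1 - x 1 * y 0) • p + (x 0 * y 2 - x 2 * y 0) • q
      + (x 1 * y 2 - x 2 * y 1) • r)
    (by intro x x' y; ext i; simp; ring)
    (by intro c x y; ext i; simp; ring)
    (by intro x y y'; ext i; simp; ring)
    (by intro c x y; ext i; simp; ring)

theorem skew3_apply (p q r x y : R3) (i : Fin 3) :
    skew3 p q r x y i = (x 0 * y 1 - x 1 * y 0) * p i + (x 0 * y 2 - x 2 * y 0) * q i
      + (x 1 * y 2 - x 2 * y 1) * r i := by
  simp [skew3]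

theorem skew3_self (p q r x : R3) : skew3 p q r x x = 0 := by
  ext i; rw [skew3_apply]; simp only [Pi.zero_apply]; ring

/-- `A_{2.1} ⊕ A_1`: `[e₁, e₂] = e₁`. -/
def A21A1 : LieBracket R3 where
  bracket := skew3 ![1, 0, 0] 0 0
  bracket_self := skew3_self _ _ _
  leibniz x y z := by ext i; fin_cases i <;> simp [skew3_apply] <;> ring

/-- `A_{3.1}` (the Heisenberg algebra): `[e₂, e₃] = e₁`. -/
def A31 : LieBracket R3 where
  bracket := skew3 0 0 ![1, 0, 0]
  bracket_self := skew3_self _ _ _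
  leibniz x y z := by ext i; fin_cases i <;> simp [skew3_apply]

/-- `A_{3.2}`: `[e₁, e₃] = e₁`, `[e₂, e₃] = e₁ + e₂`. -/
def A32 : LieBracket R3 where
  bracket := skew3 0 ![1, 0, 0] ![1, 1, 0]
  bracket_self := skew3_self _ _ _
  leibniz x y z := by ext i; fin_cases i <;> simp [skew3_apply] <;> ring

/-- `A_{3.3}`: `[e₁, e₃] = e₁`, `[e₂, e₃] = e₂`. -/
def A33 : LieBracket R3 where
  bracket := skew3 0 ![1, 0, 0] ![0, 1, 0]
  bracket_self := skew3_self _ _ _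
  leibniz x y z := by ext i; fin_cases i <;> simp [skew3_apply] <;> ring

/-- `A_{3.4}^a`: `[e₁, e₃] = e₁`, `[e₂, e₃] = a e₂`. -/
def A34 (a : ℝ) : LieBracket R3 where
  bracket := skew3 0 ![1, 0, 0] ![0, a, 0]
  bracket_self := skew3_self _ _ _
  leibniz x y z := by ext i; fin_cases i <;> simp [skew3_apply] <;> ring

/-- `A_{3.5}^b`: `[e₁, e₃] = b e₁ - e₂`, `[e₂, e₃] = e₁ + b e₂`. -/
def A35 (b : ℝ) : LieBracket R3 where
  bracket := skew3 0 ![b, -1, 0] ![1, b, 0]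
  bracket_self := skew3_self _ _ _
  leibniz x y z := by ext i; fin_cases i <;> simp [skew3_apply] <;> ring

/-- `sl(2, ℝ)`: `[e₁, e₂] = e₁`, `[e₂, e₃] = e₃`, `[e₁, e₃] = 2 e₂`. -/
def sl2 : LieBracket R3 where
  bracket := skew3 ![1, 0, 0] ![0, 2, 0] ![0, 0, 1]
  bracket_self := skew3_self _ _ _
  leibniz x y z := by ext i; fin_cases i <;> simp [skew3_apply] <;> ring

/-- `so(3)`: `[e₁, e₂] = e₃`, `[e₂, e₃] = e₁`, `[e₃, e₁] = e₂`. -/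
def so3 : LieBracket R3 where
  bracket := skew3 ![0, 0, 1] ![0, -1, 0] ![1, 0, 0]
  bracket_self := skew3_self _ _ _
  leibniz x y z := by ext i; fin_cases i <;> simp [skew3_apply] <;> ring

/-- The list of contractions. `Listed g g₀ I k S` says that the list contains the contraction
`g → g₀` with the contraction matrix `I · diag(ε ^ k₁, ε ^ k₂, ε ^ k₃)`, and, when `S = some h`, that
it is listed as a simple Inönü–Wigner contraction with associated subalgebra `h`. -/
inductive Listed : LieBracket R3 → LieBracket R3 → Matrix (Fin 3) (Fin 3) ℝ → (Fin 3 → ℤ) →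
    Option (Submodule ℝ R3) → Prop
  | A21A1_A31 : Listed A21A1 A31 !![1, 0, -1; 0, 1, 0; 0, 0, 1] ![1, 1, 0]
      (some (Submodule.span ℝ {![1, 0, -1]}))
  | A32_A31 : Listed A32 A31 !![-1, 0, 0; 0, 1, 0; 0, 0, -1] ![1, 0, 1]
      (some (Submodule.span ℝ {![0, 1, 0]}))
  | A32_A31_diag : Listed A32 A31 1 ![2, 1, 1] none
  | A32_A33 : Listed A32 A33 !![1, 0, 0; 0, 1, 1; 0, 0, 1] ![0, 1, 0]
      (some (Submodule.span ℝ {![1, 0, 0], ![0, 1, 1]}))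
  | A32_A33_diag : Listed A32 A33 1 ![1, 2, 0] none
  | A34_A31 (a : ℝ) (h₁ : -1 ≤ a) (h₂ : a < 1) (h₀ : a ≠ 0) :
      Listed (A34 a) A31 !![1 - a, 1, 0; 0, 1, 0; 0, 0, 1] ![1, 0, 1]
        (some (Submodule.span ℝ {![1, 1, 0]}))
  | A35_A31 (b : ℝ) (hb : 0 ≤ b) : Listed (A35 b) A31 1 ![1, 0, 1]
      (some (Submodule.span ℝ {![0, 1, 0]}))
  | sl2_A31 : Listed sl2 A31 !![0, 1, 0; 2, 0, 0; 0, 0, 1] ![1, 1, 0]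
      (some (Submodule.span ℝ {![0, 0, 1]}))
  | sl2_A34 : Listed sl2 (A34 (-1)) !![1, 0, 0; 0, 0, 1; 0, -1, 0] ![1, 0, 0]
      (some (Submodule.span ℝ {![0, 1, 0], ![0, 0, 1]}))
  | sl2_A35 : Listed sl2 (A35 0) !![0, 0, 1 / 2; 0, 1, 0; 1, 0, 1 / 2] ![1, 1, 0]
      (some (Submodule.span ℝ {![1, 0, 1]}))
  | so3_A31 : Listed so3 A31 1 ![2, 1, 1] none
  | so3_A35 : Listed so3 (A35 0) 1 ![1, 1, 0]
      (some (Submodule.span ℝ {![0, 0, 1]}))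

end

/-! The proof classifies the algebras, excludes the impossible pairs and exhibits the others.

Classification (`exists_canonical`): on `R3` the bracket is [x, y] = N(x × y), and the Jacobi
identity says that N kills the axial vector a of its antisymmetric part. If N is invertible, then a
= 0, N is symmetric, and the spectral theorem with rescaling leaves only so(3) and sl(2, ℝ).
Otherwise some c ≠ 0 lies in both the left and the right kernel of N. The plane orthogonal to c is
then an Abelian ideal, and one operator on that plane, up to scale, determines the algebra.

Exclusion (`Degenerates.isListed`): a contraction makes g₀ a limit of algebras isomorphic to g, so
every closed isomorphism-invariant condition on g passes to g₀. The conditions used are polynomial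
identities such as metabelianity, a fixed ratio between (tr ad x)² and the Killing form, and
semidefiniteness of the Killing form. They eliminate every pair of distinct canonical algebras with
non-Abelian target outside the list, except sl(2, ℝ) → so(3), which fails because negative
definiteness is an open condition (`not_sl2_so3`). The same conditions, read along a supposed
isomorphism, show that the listed contractions are proper.

Existence (`Listed.exists_contraction`): for each listed matrix the transformed structure constants
are polynomials in ε whose values at 0 are those of the target. Improper contractions are
represented by the identity, trivial ones by ε · id.

For so(3) → A_{3.1} (`not_isSimpleIW`): on a vector of the first block the transformed Killing form
has a nonzero limit, whereas the Killing form of A_{3.1} vanishes; with an empty first block the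
limit is Abelian. -/

namespace LieBracket

/-! ### Isomorphisms and transport of brackets -/

section Iso

variable {V W X : Type*} [AddCommGroup V] [Module ℝ V] [AddCommGroup W] [Module ℝ W]
  [AddCommGroup X] [Module ℝ X]

theorem isomorphic_iff {μ : LieBracket V} {ν : LieBracket W} :
    μ.Isomorphic ν ↔
      ∃ e : V ≃ₗ[ℝ] W, ∀ x y, e (μ.bracket x y) = ν.bracket (e x) (e y) := by
  constructor
  · rintro ⟨e⟩
    exact ⟨(e.toLinearEquiv : μ.Algebra ≃ₗ[ℝ] ν.Algebra), fun x y => e.map_lie x y⟩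
  · rintro ⟨e, h⟩
    exact ⟨{ (show μ.Algebra ≃ₗ[ℝ] ν.Algebra from e) with map_lie' := fun {x y} => h x y }⟩

theorem Isomorphic.refl (μ : LieBracket V) : μ.Isomorphic μ :=
  ⟨LieEquiv.refl⟩

theorem Isomorphic.symm {μ : LieBracket V} {ν : LieBracket W} (h : μ.Isomorphic ν) :
    ν.Isomorphic μ :=
  h.elim fun e => ⟨e.symm⟩

theorem Isomorphic.trans {μ : LieBracket V} {ν : LieBracket W} {ρ : LieBracket X}
    (h : μ.Isomorphic ν) (h' : ν.Isomorphic ρ) : μ.Isomorphic ρ :=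
  h.elim fun e => h'.elim fun e' => ⟨e.trans e'⟩

theorem bracket_skew (μ : LieBracket V) (x y : V) : μ.bracket x y = -μ.bracket y x := by
  have h := μ.bracket_self (x + y)
  simp only [map_add, LinearMap.add_apply, μ.bracket_self] at h
  rw [zero_add, add_zero] at h
  exact eq_neg_of_add_eq_zero_right h

theorem isLieAbelian_iff (μ : LieBracket V) :
    IsLieAbelian μ.Algebra ↔ ∀ x y, μ.bracket x y = 0 :=
  ⟨fun h x y => h.trivial x y, fun h => ⟨fun x y => h x y⟩⟩

/-- The bracket on `W` transported to `V` along a linear equivalence. -/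
def pullback (ν : LieBracket W) (e : V ≃ₗ[ℝ] W) : LieBracket V where
  bracket := (ν.bracket.compl₁₂ e.toLinearMap e.toLinearMap).compr₂ e.symm.toLinearMap
  bracket_self x := by simp [ν.bracket_self]
  leibniz x y z := by simp [ν.leibniz (e x) (e y) (e z)]

@[simp]
theorem pullback_bracket (ν : LieBracket W) (e : V ≃ₗ[ℝ] W) (x y : V) :
    (ν.pullback e).bracket x y = e.symm (ν.bracket (e x) (e y)) := rfl

theorem pullback_isomorphic (ν : LieBracket W) (e : V ≃ₗ[ℝ] W) : (ν.pullback e).Isomorphic ν :=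
  isomorphic_iff.2 ⟨e, fun x y => by simp⟩

theorem isomorphic_of_basis {μ : LieBracket V} (b : Module.Basis (Fin 3) ℝ V)
    {ν : LieBracket R3} {p q r : R3} (hν : ν.bracket = skew3 p q r)
    (hp : μ.bracket (b 0) (b 1) = p 0 • b 0 + p 1 • b 1 + p 2 • b 2)
    (hq : μ.bracket (b 0) (b 2) = q 0 • b 0 + q 1 • b 1 + q 2 • b 2)
    (hr : μ.bracket (b 1) (b 2) = r 0 • b 0 + r 1 • b 1 + r 2 • b 2) : μ.Isomorphic ν := by
  refine Isomorphic.symm (isomorphic_iff.2 ⟨b.equivFun.symm, fun x y => ?_⟩)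
  rw [hν]
  simp only [Module.Basis.equivFun_symm_apply, Fin.sum_univ_three, map_add, map_smul,
    LinearMap.add_apply, LinearMap.smul_apply, skew3_apply, μ.bracket_self,
    μ.bracket_skew (b 1) (b 0), μ.bracket_skew (b 2) (b 0), μ.bracket_skew (b 2) (b 1), hp, hq, hr]
  module

theorem isomorphic_of_matrix {μ ν : LieBracket R3} (A : Matrix (Fin 3) (Fin 3) ℝ)
    (hA : A.det ≠ 0)
    (h : ∀ x y, μ.bracket (A.mulVec x) (A.mulVec y) = A.mulVec (ν.bracket x y)) :
    μ.Isomorphic ν := by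
  have := A.invertibleOfIsUnitDet (isUnit_iff_ne_zero.2 hA)
  refine Isomorphic.symm (isomorphic_iff.2
    ⟨Matrix.toLin'OfInv (M := ⅟A) (M' := A) (by simp) (by simp), fun x y => ?_⟩)
  simp [Matrix.toLin'OfInv, h]

end Iso

/-! ### Normal forms: the companion and the diagonal families -/

theorem bracket_eq_skew3 (μ : LieBracket R3) :
    μ.bracket = skew3 (μ.bracket (Pi.single 0 1) (Pi.single 1 1))
      (μ.bracket (Pi.single 0 1) (Pi.single 2 1)) (μ.bracket (Pi.single 1 1) (Pi.single 2 1)) := by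
  refine (Pi.basisFun ℝ (Fin 3)).ext fun i => (Pi.basisFun ℝ (Fin 3)).ext fun j => ?_
  simp only [Pi.basisFun_apply]
  have h10 := μ.bracket_skew (Pi.single 1 1) (Pi.single 0 1)
  have h20 := μ.bracket_skew (Pi.single 2 1) (Pi.single 0 1)
  have h21 := μ.bracket_skew (Pi.single 2 1) (Pi.single 1 1)
  ext k
  rw [skew3_apply]
  fin_cases i <;> fin_cases j <;> simp [μ.bracket_self, h10, h20, h21]

/-- The Abelian algebra. -/
def abelian3 : LieBracket R3 where
  bracket := 0
  bracket_self := by simp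
  leibniz := by simp

/-- `ℝ ⋉ ℝ²` with the companion matrix of `X² - t X + d`. -/
def companion (t d : ℝ) : LieBracket R3 where
  bracket := skew3 0 ![0, 1, 0] ![-d, t, 0]
  bracket_self := skew3_self _ _ _
  leibniz x y z := by ext i; fin_cases i <;> simp [skew3_apply] <;> ring

/-- The algebras `[e₂, e₃] = l e₁`, `[e₃, e₁] = m e₂`, `[e₁, e₂] = n e₃`. -/
def diagonal3 (l m n : ℝ) : LieBracket R3 where
  bracket := skew3 ![0, 0, n] ![0, -m, 0] ![l, 0, 0]
  bracket_self := skew3_self _ _ _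
  leibniz x y z := by ext i; fin_cases i <;> simp [skew3_apply] <;> ring

/-- After e₃ is scaled by s, the operator [·, s e₃] on the plane has eigenvalues s and s a. The
matrix sends e₁ to the cyclic vector e₁ + e₂, e₂ to its image under this operator, and e₃ to s e₃.
The next two lemmas use the cyclic vector e₂ in the same way. -/
theorem companion_isomorphic_A34 {a s : ℝ} (ha : a ≠ 1) (hs : s ≠ 0) :
    (companion (s * (1 + a)) (s ^ 2 * a)).Isomorphic (A34 a) := by
  refine Isomorphic.symm (isomorphic_of_matrix !![1, s, 0; 1, s * a, 0; 0, 0, s] ?_ fun x y => ?_)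
  · simp only [Matrix.det_fin_three, Matrix.of_apply, Matrix.cons_val]
    have : s * s * (a - 1) ≠ 0 := mul_ne_zero (mul_ne_zero hs hs) (sub_ne_zero.2 ha)
    convert this using 1; ring
  · ext i
    fin_cases i <;>
      simp [A34, companion, skew3_apply, Matrix.mulVec, dotProduct, Fin.sum_univ_three] <;> ring

theorem companion_isomorphic_A32 {s : ℝ} (hs : s ≠ 0) :
    (companion (2 * s) (s ^ 2)).Isomorphic A32 := by
  refine Isomorphic.symm (isomorphic_of_matrix !![0, s, 0; 1, s, 0; 0, 0, s] ?_ fun x y => ?_)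
  · simp [Matrix.det_fin_three, hs]
  · ext i
    fin_cases i <;>
      simp [A32, companion, skew3_apply, Matrix.mulVec, dotProduct, Fin.sum_univ_three] <;> ring

theorem companion_isomorphic_A35 (b : ℝ) {s : ℝ} (hs : s ≠ 0) :
    (companion (2 * b * s) (s ^ 2 * (b ^ 2 + 1))).Isomorphic (A35 b) := by
  refine Isomorphic.symm (isomorphic_of_matrix !![0, s, 0; 1, s * b, 0; 0, 0, s] ?_ fun x y => ?_)
  · simp [Matrix.det_fin_three, hs]
  · ext i
    fin_cases i <;>
      simp [A35, companion, skew3_apply, Matrix.mulVec, dotProduct, Fin.sum_univ_three] <;> ring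

theorem companion_isomorphic_A31 : (companion 0 0).Isomorphic A31 := by
  refine Isomorphic.symm (isomorphic_of_matrix !![0, 1, 0; 1, 0, 0; 0, 0, 1] ?_ fun x y => ?_)
  · simp [Matrix.det_fin_three]
  · ext i
    fin_cases i <;>
      simp [A31, companion, skew3_apply, Matrix.mulVec, dotProduct, Fin.sum_univ_three]

theorem A34_zero_isomorphic_A21A1 : (A34 0).Isomorphic A21A1 := by
  refine isomorphic_of_matrix !![1, 0, 0; 0, 0, 1; 0, 1, 0] ?_ fun x y => ?_
  · simp [Matrix.det_fin_three]
  · ext i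
    fin_cases i <;>
      simp [A34, A21A1, skew3_apply, Matrix.mulVec, dotProduct, Fin.sum_univ_three]

theorem diagonal3_scale {l m n s₁ s₂ s₃ : ℝ} (h₁ : s₁ ≠ 0) (h₂ : s₂ ≠ 0) (h₃ : s₃ ≠ 0) :
    (diagonal3 l m n).Isomorphic
      (diagonal3 (s₂ * s₃ / s₁ * l) (s₃ * s₁ / s₂ * m) (s₁ * s₂ / s₃ * n)) := by
  refine isomorphic_of_matrix !![s₁, 0, 0; 0, s₂, 0; 0, 0, s₃] ?_ fun x y => ?_
  · simp [Matrix.det_fin_three, h₁, h₂, h₃]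
  · ext i
    fin_cases i <;>
      simp [diagonal3, skew3_apply, Matrix.mulVec, dotProduct, Fin.sum_univ_three] <;>
      field_simp

theorem diagonal3_rotate (l m n : ℝ) : (diagonal3 l m n).Isomorphic (diagonal3 m n l) := by
  refine isomorphic_of_matrix !![0, 0, 1; 1, 0, 0; 0, 1, 0] ?_ fun x y => ?_
  · simp [Matrix.det_fin_three]
  · ext i
    fin_cases i <;>
      simp [diagonal3, skew3_apply, Matrix.mulVec, dotProduct, Fin.sum_univ_three] <;> ring

theorem diagonal3_neg (l m n : ℝ) : (diagonal3 l m n).Isomorphic (diagonal3 (-l) (-m) (-n)) := by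
  refine isomorphic_of_matrix !![-1, 0, 0; 0, -1, 0; 0, 0, -1] ?_ fun x y => ?_
  · simp [Matrix.det_fin_three]
  · ext i
    fin_cases i <;>
      simp [diagonal3, skew3_apply, Matrix.mulVec, dotProduct, Fin.sum_univ_three]

theorem diagonal3_one_isomorphic_so3 : (diagonal3 1 1 1).Isomorphic so3 :=
  Isomorphic.refl _

theorem diagonal3_neg_one_isomorphic_sl2 : (diagonal3 1 1 (-1)).Isomorphic sl2 := by
  refine Isomorphic.symm
    (isomorphic_of_matrix !![-1 / 2, 0, 1 / 2; 0, 1, 0; 1 / 2, 0, 1 / 2] ?_ fun x y => ?_)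
  · simp [Matrix.det_fin_three]; norm_num
  · ext i
    fin_cases i <;>
      simp [diagonal3, sl2, skew3_apply, Matrix.mulVec, dotProduct, Fin.sum_univ_three] <;> ring

end LieBracket

/-! ### Classification of real three-dimensional Lie algebras -/

namespace LieBracket

/-- The canonical real three-dimensional Lie algebras; `A34 0` stands for `A21A1`. -/
inductive Canonical : LieBracket R3 → Prop
  | abelian : Canonical abelian3
  | A31 : Canonical A31
  | A32 : Canonical A32
  | A33 : Canonical A33
  | A34 (a : ℝ) (h₁ : -1 ≤ a) (h₂ : a < 1) : Canonical (A34 a)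
  | A35 (b : ℝ) (hb : 0 ≤ b) : Canonical (A35 b)
  | sl2 : Canonical sl2
  | so3 : Canonical so3

/-- The discriminant of X² - t X + d decides: complex eigenvalues give `A35`, a double one gives
`A31` or `A32`, and distinct real ones give `A34`. The eigenvalues matter only up to a common
nonzero factor. -/
theorem exists_canonical_companion (t d : ℝ) : ∃ g, Canonical g ∧ (companion t d).Isomorphic g := by
  rcases lt_trichotomy (t ^ 2 - 4 * d) 0 with h | h | h
  · set D := √(-(t ^ 2 - 4 * d)) with hD
    have hD0 : 0 < D := Real.sqrt_pos.2 (by linarith)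
    have hD2 : D ^ 2 = 4 * d - t ^ 2 := by rw [hD, Real.sq_sqrt (by linarith)]; ring
    rcases le_total 0 t with ht | ht
    · refine ⟨_, .A35 (t / D) (by positivity), ?_⟩
      have := companion_isomorphic_A35 (t / D) (s := D / 2) (by positivity)
      convert this using 2
      · field_simp
      · field_simp; linarith
    · refine ⟨_, .A35 (-t / D) (div_nonneg (by linarith) hD0.le), ?_⟩
      -- A negative scale reverses the sign of the real part, which makes the parameter nonnegative.
      have := companion_isomorphic_A35 (-t / D) (s := -D / 2) (by
        have := hD0.ne'
        simpa using this)
      convert this using 2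
      · field_simp
      · field_simp; linarith
  · by_cases ht : t = 0
    · subst ht
      obtain rfl : d = 0 := by linarith
      exact ⟨_, .A31, companion_isomorphic_A31⟩
    · refine ⟨_, .A32, ?_⟩
      have := companion_isomorphic_A32 (s := t / 2) (by simpa using ht)
      convert this using 2
      · ring
      · linarith
  · set D := √(t ^ 2 - 4 * d) with hD
    have hD0 : 0 < D := Real.sqrt_pos.2 h
    have hD2 : D ^ 2 = t ^ 2 - 4 * d := Real.sq_sqrt h.le
    rcases le_or_gt 0 t with ht | ht
    · have hp : 0 < t + D := by linarith
      have h1 : (t - D) / (t + D) < 1 := by rw [div_lt_one hp]; linarith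
      refine ⟨_, .A34 ((t - D) / (t + D)) (by rw [le_div_iff₀ hp]; linarith) h1, ?_⟩
      have := companion_isomorphic_A34 h1.ne (s := (t + D) / 2) (by positivity)
      convert this using 2
      · field_simp; ring
      · field_simp; linarith
    · have hp : 0 < -t + D := by linarith
      have h1 : (-t - D) / (-t + D) < 1 := by rw [div_lt_one hp]; linarith
      refine ⟨_, .A34 ((-t - D) / (-t + D)) (by rw [le_div_iff₀ hp]; linarith) h1, ?_⟩
      have := companion_isomorphic_A34 h1.ne (s := -(-t + D) / 2) (by
        have := hp.ne'
        simpa only [ne_eq, div_eq_zero_iff, neg_eq_zero, OfNat.ofNat_ne_zero, or_false] using this)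
      convert this using 2
      · field_simp; ring
      · field_simp; linarith

section Ideal

variable {V : Type*} [AddCommGroup V] [Module ℝ V]

theorem linearIndependent_of_ker {ψ : V →ₗ[ℝ] ℝ} {v w c : V} (h : LinearIndependent ℝ ![v, w])
    (hv : ψ v = 0) (hw : ψ w = 0) (hc : ψ c ≠ 0) : LinearIndependent ℝ ![v, w, c] := by
  rw [Fintype.linearIndependent_iff]
  intro g hg
  simp only [Fin.sum_univ_three, Matrix.cons_val] at hg
  have h2 : g 2 = 0 := by
    have := congrArg ψ hg
    simpa [hv, hw, hc] using this
  rw [h2, zero_smul, add_zero] at hg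
  obtain ⟨h0, h1⟩ := LinearIndependent.pair_iff.1 h _ _ hg
  intro i
  fin_cases i <;> assumption

/-- All structure is in the operator [·, c] on the plane ker ψ. Either it is scalar, or some vector
is not an eigenvector; such a vector is cyclic and yields a companion matrix. -/
theorem exists_canonical_of_abelian_ideal (hV : Module.finrank ℝ V = 3) (μ : LieBracket V)
    (ψ : V →ₗ[ℝ] ℝ) {c : V} (hc : ψ c ≠ 0)
    (h0 : ∀ x y, ψ x = 0 → ψ y = 0 → μ.bracket x y = 0) (h1 : ∀ x y, ψ (μ.bracket x y) = 0) :
    ∃ g, Canonical g ∧ μ.Isomorphic g := by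
  have : FiniteDimensional ℝ V := Module.finite_of_finrank_eq_succ hV
  by_cases h : ∀ v, ψ v = 0 → ∃ k : ℝ, μ.bracket v c = k • v
  · have hker : Module.finrank ℝ (LinearMap.ker ψ) = 2 := by
      have hr : Module.finrank ℝ (LinearMap.range ψ) = 1 := by
        rw [LinearMap.range_eq_top.2 (LinearMap.surjective (fun h' => hc (by simp [h']))),
          finrank_top, Module.finrank_self]
      have := LinearMap.finrank_range_add_finrank_ker ψ
      omega
    let f := Module.finBasisOfFinrankEq ℝ (LinearMap.ker ψ) hker
    have hf0 : ψ (f 0) = 0 := (f 0).2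
    have hf1 : ψ (f 1) = 0 := (f 1).2
    have hli : LinearIndependent ℝ ![(f 0 : V), (f 1 : V)] := by
      have h := f.linearIndependent.map' (LinearMap.ker ψ).subtype (Submodule.ker_subtype _)
      have hf : ![(f 0 : V), (f 1 : V)] = (LinearMap.ker ψ).subtype ∘ f := by
        ext i; fin_cases i <;> rfl
      rwa [hf]
    obtain ⟨k, hk⟩ := h _ hf0
    obtain ⟨k', hk'⟩ := h _ hf1
    -- That the sum of two basis vectors is an eigenvector forces the two eigenvalues to agree.
    obtain ⟨l, hl⟩ := h (f 0 + f 1) (by simp [hf0, hf1])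
    have hkk : k = k' := by
      have : (k - l) • (f 0 : V) + (k' - l) • (f 1 : V) = 0 := by
        rw [map_add, LinearMap.add_apply, hk, hk'] at hl
        have := sub_eq_zero.2 hl
        rw [← this]
        module
      obtain ⟨h1, h2⟩ := LinearIndependent.pair_iff.1 hli _ _ this
      linarith
    subst hkk
    by_cases hk0 : k = 0
    · subst hk0
      let b := basisOfLinearIndependentOfCardEqFinrank (linearIndependent_of_ker hli hf0 hf1 hc)
        (by simp [hV])
      refine ⟨_, .abelian, isomorphic_of_basis b (p := 0) (q := 0) (r := 0) ?_ ?_ ?_ ?_⟩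
      · ext; simp [abelian3, skew3_apply]
      · simp [b, h0 _ _ hf0 hf1]
      · simp [b, hk]
      · simp [b, hk']
    · let b := basisOfLinearIndependentOfCardEqFinrank
        (linearIndependent_of_ker (c := k⁻¹ • c) hli hf0 hf1 (by simp [hc, hk0])) (by simp [hV])
      refine ⟨_, .A33, isomorphic_of_basis b rfl ?_ ?_ ?_⟩
      · simp [b, h0 _ _ hf0 hf1]
      · simp [b, hk, hk0]
      · simp [b, hk', hk0]
  · push Not at h
    obtain ⟨v, hv, hvk⟩ := h
    set w := μ.bracket v c with hw
    have hψw : ψ w = 0 := h1 _ _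
    have hv0 : v ≠ 0 := by
      rintro rfl
      exact hvk 0 (by simp [hw])
    have hli : LinearIndependent ℝ ![v, w] :=
      (LinearIndependent.pair_iff' hv0).2 fun a h => hvk a h.symm
    let b := basisOfLinearIndependentOfCardEqFinrank (linearIndependent_of_ker hli hv hψw hc)
      (by simp [hV])
    have hb0 : b 0 = v := by simp [b]
    have hb1 : b 1 = w := by simp [b]
    have hb2 : b 2 = c := by simp [b]
    have hr := b.sum_repr (μ.bracket w c)
    rw [Fin.sum_univ_three, hb0, hb1, hb2] at hr
    set α := b.repr (μ.bracket w c)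
    -- The derived algebra lies in ker ψ, so [w, c] has no component along c.
    have h2 : α 2 = 0 := by
      have := congrArg ψ hr
      simpa [hv, hψw, hc, h1] using this
    obtain ⟨g, hg, hi⟩ := exists_canonical_companion (α 1) (-α 0)
    refine ⟨g, hg, Isomorphic.trans (isomorphic_of_basis b rfl ?_ ?_ ?_) hi⟩
    · simp [hb0, hb1, h0 _ _ hv hψw]
    · simp [hb0, hb1, hb2, ← hw]
    · rw [hb0, hb1, hb2, ← hr, h2]
      simp

end Ideal

/-- The matrix `N` with `[x, y] = N (x ×₃ y)`. -/
def crossMatrix (p q r : R3) : Matrix (Fin 3) (Fin 3) ℝ :=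
  !![r 0, -q 0, p 0; r 1, -q 1, p 1; r 2, -q 2, p 2]

/-- The ideal is the plane orthogonal to c. The cross product of two vectors of this plane is a
multiple of c, which N kills; and the image of N is orthogonal to c because c is in the left kernel.
-/
theorem exists_canonical_of_det_eq_zero (μ : LieBracket R3) {p q r : R3}
    (hμ : μ.bracket = skew3 p q r) {c : R3} (hc : c ≠ 0)
    (hN : (crossMatrix p q r).mulVec c = 0) (hN' : (crossMatrix p q r).vecMul c = 0) :
    ∃ g, Canonical g ∧ μ.Isomorphic g := by
  have hcc : c ⬝ᵥ c ≠ 0 := by simpa using hc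
  have hn : ∀ i, c 0 * r i - c 1 * q i + c 2 * p i = 0 := fun i => by
    have := congrFun hN i
    fin_cases i <;> simp [crossMatrix, Matrix.mulVec, dotProduct, Fin.sum_univ_three] at this ⊢ <;>
      linarith
  have hr : c 0 * r 0 + c 1 * r 1 + c 2 * r 2 = 0 := by
    have := congrFun hN' 0
    simpa [crossMatrix, Matrix.vecMul, dotProduct, Fin.sum_univ_three] using this
  have hq : c 0 * q 0 + c 1 * q 1 + c 2 * q 2 = 0 := by
    have := congrFun hN' 1
    simp [crossMatrix, Matrix.vecMul, dotProduct, Fin.sum_univ_three] at this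
    linarith
  have hp : c 0 * p 0 + c 1 * p 1 + c 2 * p 2 = 0 := by
    have := congrFun hN' 2
    simpa [crossMatrix, Matrix.vecMul, dotProduct, Fin.sum_univ_three] using this
  let ψ : R3 →ₗ[ℝ] ℝ := dotProductBilin ℝ ℝ c
  have hψ : ∀ x, ψ x = c 0 * x 0 + c 1 * x 1 + c 2 * x 2 := fun x => by
    simp [ψ, dotProductBilin, dotProduct, Fin.sum_univ_three]
  refine exists_canonical_of_abelian_ideal (by simp) μ ψ (c := c) hcc (fun x y hx hy => ?_)
    fun x y => ?_
  · rw [hψ] at hx hy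
    ext i
    -- For x and y orthogonal to c, (c · c)(x × y) = (c · (x × y)) c, to which N is applied.
    have : (c ⬝ᵥ c) * μ.bracket x y i = 0 := by
      rw [hμ, skew3_apply]
      simp only [dotProduct, Fin.sum_univ_three]
      linear_combination (c 0 * (x 1 * y 2 - x 2 * y 1) + c 1 * (x 2 * y 0 - x 0 * y 2)
          + c 2 * (x 0 * y 1 - x 1 * y 0)) * hn i
        + r i * (c 2 * (x 1 * hy - y 1 * hx) - c 1 * (x 2 * hy - y 2 * hx))
        - q i * (c 0 * (x 2 * hy - y 2 * hx) - c 2 * (x 0 * hy - y 0 * hx))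
        + p i * (c 1 * (x 0 * hy - y 0 * hx) - c 0 * (x 1 * hy - y 1 * hx))
    simpa [hcc] using this
  · rw [hψ, hμ]
    simp only [skew3_apply]
    linear_combination (x 0 * y 1 - x 1 * y 0) * hp + (x 0 * y 2 - x 2 * y 0) * hq
      + (x 1 * y 2 - x 2 * y 1) * hr

/-- For every P one has Pᵀ(Px × Py) = det P • (x × y), the cofactor identity; orthogonality then
inverts Pᵀ. -/
theorem crossProduct_mulVec_of_orthogonal {P : Matrix (Fin 3) (Fin 3) ℝ}
    (hP : P * P.transpose = 1) (x y : R3) :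
    crossProduct (P.mulVec x) (P.mulVec y) = P.det • P.mulVec (crossProduct x y) := by
  have h : P.transpose.mulVec (crossProduct (P.mulVec x) (P.mulVec y))
      = P.det • crossProduct x y := by
    ext i
    fin_cases i <;>
      simp [cross_apply, Matrix.mulVec, dotProduct, Fin.sum_univ_three, Matrix.det_fin_three] <;>
      ring
  have := congrArg P.mulVec h
  rwa [Matrix.mulVec_mulVec, hP, Matrix.one_mulVec, Matrix.mulVec_smul] at this

theorem skew3_eq_mulVec (p q r x y : R3) :
    skew3 p q r x y = (crossMatrix p q r).mulVec (crossProduct x y) := by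
  ext i
  rw [skew3_apply]
  fin_cases i <;>
    simp [crossMatrix, cross_apply, Matrix.mulVec, dotProduct, Fin.sum_univ_three] <;> ring

/-- An orthogonal change of basis conjugates N, up to the factor det P coming from the cross
product, so the spectral theorem diagonalizes the bracket. -/
theorem exists_isomorphic_diagonal3 (μ : LieBracket R3) {p q r : R3}
    (hμ : μ.bracket = skew3 p q r) (hN : (crossMatrix p q r).IsHermitian)
    (hdet : (crossMatrix p q r).det ≠ 0) :
    ∃ l m n : ℝ, l ≠ 0 ∧ m ≠ 0 ∧ n ≠ 0 ∧ μ.Isomorphic (diagonal3 l m n) := by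
  set N := crossMatrix p q r
  set P : Matrix (Fin 3) (Fin 3) ℝ := hN.eigenvectorUnitary.1
  set e := hN.eigenvalues
  have hP : P * P.transpose = 1 := by
    have := Unitary.coe_mul_star_self hN.eigenvectorUnitary
    simpa [Matrix.star_eq_conjTranspose, Matrix.conjTranspose_eq_transpose_of_trivial] using this
  have hP' : P.transpose * P = 1 := mul_eq_one_comm.1 hP
  have hPdet : P.det ≠ 0 := by
    intro h
    have := congrArg Matrix.det hP
    simp [h] at this
  have hNP : N * P = P * Matrix.diagonal e := by
    have h := hN.spectral_theorem
    rw [Unitary.conjStarAlgAut_apply] at h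
    have : N = P * Matrix.diagonal e * P.transpose := by
      simpa [Matrix.star_eq_conjTranspose, Matrix.conjTranspose_eq_transpose_of_trivial,
        Function.comp_def] using h
    conv_lhs => rw [this, Matrix.mul_assoc, hP', Matrix.mul_one]
  have he : ∀ i, e i ≠ 0 := by
    intro i hi
    have := congrArg Matrix.det hNP
    rw [Matrix.det_mul, Matrix.det_mul, Matrix.det_diagonal,
      Finset.prod_eq_zero (Finset.mem_univ i) hi, mul_zero] at this
    exact mul_ne_zero hdet hPdet this
  refine ⟨P.det * e 0, P.det * e 1, P.det * e 2, mul_ne_zero hPdet (he 0), mul_ne_zero hPdet (he 1),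
    mul_ne_zero hPdet (he 2), isomorphic_of_matrix P hPdet fun x y => ?_⟩
  rw [hμ, skew3_eq_mulVec, crossProduct_mulVec_of_orthogonal hP, Matrix.mulVec_smul,
    Matrix.mulVec_mulVec]
  change P.det • (N * P).mulVec _ = _
  rw [hNP, ← Matrix.mulVec_mulVec, ← Matrix.mulVec_smul]
  congr 1
  ext i
  fin_cases i <;>
    simp [diagonal3, skew3_apply, cross_apply, Matrix.mulVec_diagonal] <;> ring

theorem diagonal3_isomorphic_sign {l m n : ℝ} (hl : l ≠ 0) (hm : m ≠ 0) (hn : n ≠ 0) :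
    (diagonal3 l m n).Isomorphic
      (diagonal3 (SignType.sign l) (SignType.sign m) (SignType.sign n)) := by
  set a := √|l| with ha
  set b := √|m| with hb
  set c := √|n| with hc
  have ha0 : 0 < a := Real.sqrt_pos.2 (abs_pos.2 hl)
  have hb0 : 0 < b := Real.sqrt_pos.2 (abs_pos.2 hm)
  have hc0 : 0 < c := Real.sqrt_pos.2 (abs_pos.2 hn)
  -- With these scales s₂ s₃ / s₁ = 1 / a² = 1 / |l|, and cyclically.
  have h := diagonal3_scale (l := l) (m := m) (n := n) (s₁ := (b * c)⁻¹) (s₂ := (c * a)⁻¹)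
    (s₃ := (a * b)⁻¹) (by positivity) (by positivity) (by positivity)
  have key : ∀ x : ℝ, (SignType.sign x : ℝ) * √|x| ^ 2 = x := fun x => by
    rw [Real.sq_sqrt (abs_nonneg x), sign_mul_abs]
  have hl' := key l
  have hm' := key m
  have hn' := key n
  convert h using 2
  · conv_rhs => rw [← hl', ← ha]
    field_simp
  · conv_rhs => rw [← hm', ← hb]
    field_simp
  · conv_rhs => rw [← hn', ← hc]
    field_simp

/-- Rotations and a global sign change reduce the eight sign patterns to (1, 1, 1) and (1, 1, -1).
-/
theorem exists_canonical_diagonal3 {l m n : ℝ} (hl : l ≠ 0) (hm : m ≠ 0) (hn : n ≠ 0) :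
    ∃ g, Canonical g ∧ (diagonal3 l m n).Isomorphic g := by
  have hs : ∀ x : ℝ, x ≠ 0 → (SignType.sign x : ℝ) = 1 ∨ (SignType.sign x : ℝ) = -1 := by
    intro x hx
    rcases lt_or_gt_of_ne hx with h | h
    · simp [sign_neg h]
    · simp [sign_pos h]
  have key : ∃ g, Canonical g ∧
      (diagonal3 (SignType.sign l) (SignType.sign m) (SignType.sign n)).Isomorphic g := by
    have h1 := diagonal3_one_isomorphic_so3
    have h2 := diagonal3_neg_one_isomorphic_sl2
    have h3 := (diagonal3_rotate (-1) 1 1).trans h2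
    have h4 := (diagonal3_rotate 1 (-1) 1).trans h3
    have n1 := diagonal3_neg (-1) (-1) (-1)
    have n2 := diagonal3_neg (-1) (-1) 1
    have n3 := diagonal3_neg 1 (-1) (-1)
    have n4 := diagonal3_neg (-1) 1 (-1)
    simp only [neg_neg] at n1 n2 n3 n4
    rcases hs l hl with h | h <;> rcases hs m hm with h' | h' <;> rcases hs n hn with h'' | h'' <;>
      rw [h, h', h'']
    · exact ⟨_, .so3, h1⟩
    · exact ⟨_, .sl2, h2⟩
    · exact ⟨_, .sl2, h4⟩
    · exact ⟨_, .sl2, n3.trans h3⟩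
    · exact ⟨_, .sl2, h3⟩
    · exact ⟨_, .sl2, n4.trans h4⟩
    · exact ⟨_, .sl2, n2.trans h2⟩
    · exact ⟨_, .so3, n1.trans h1⟩
  obtain ⟨g, hg, hi⟩ := key
  exact ⟨g, hg, (diagonal3_isomorphic_sign hl hm hn).trans hi⟩

theorem exists_canonical_R3 (μ : LieBracket R3) : ∃ g, Canonical g ∧ μ.Isomorphic g := by
  obtain ⟨p, q, r, hμ⟩ : ∃ p q r, μ.bracket = skew3 p q r := ⟨_, _, _, μ.bracket_eq_skew3⟩
  -- This is the axial vector of N - Nᵀ; the Jacobi identity on the basis vectors reads N a = 0.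
  set a : R3 := ![-(q 2 + p 1), p 0 - r 2, r 1 + q 0] with ha
  have hNa : (crossMatrix p q r).mulVec a = 0 := by
    have h := μ.leibniz (Pi.single 0 1) (Pi.single 1 1) (Pi.single 2 1)
    rw [hμ] at h
    ext i
    have := congrFun h i
    simp only [skew3_apply, Pi.add_apply] at this
    fin_cases i <;>
      simp [crossMatrix, Matrix.mulVec, dotProduct, Fin.sum_univ_three, a] at this ⊢ <;>
      linear_combination this
  by_cases ha0 : a = 0
  · have h0 := congrFun ha0 0
    have h1 := congrFun ha0 1
    have h2 := congrFun ha0 2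
    simp [a] at h0 h1 h2
    have hN : (crossMatrix p q r).transpose = crossMatrix p q r := by
      ext i j
      fin_cases i <;> fin_cases j <;> simp [crossMatrix] <;> linarith
    by_cases hdet : (crossMatrix p q r).det = 0
    · obtain ⟨c, hc, hNc⟩ := Matrix.exists_mulVec_eq_zero_iff.2 hdet
      refine exists_canonical_of_det_eq_zero μ hμ hc hNc ?_
      rw [← hN, Matrix.vecMul_transpose, hNc]
    · obtain ⟨l, m, n, hl, hm, hn, hi⟩ := exists_isomorphic_diagonal3 μ hμ
        (by rw [Matrix.IsHermitian, Matrix.conjTranspose_eq_transpose_of_trivial, hN]) hdet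
      obtain ⟨g, hg, hi'⟩ := exists_canonical_diagonal3 hl hm hn
      exact ⟨g, hg, hi.trans hi'⟩
  -- (N - Nᵀ) a = a × a = 0, so a is in the left kernel as well.
  · refine exists_canonical_of_det_eq_zero μ hμ ha0 hNa ?_
    rw [← hNa]
    ext i
    fin_cases i <;>
      simp [crossMatrix, Matrix.mulVec, Matrix.vecMul, dotProduct, Fin.sum_univ_three, a] <;>
      ring

/-- The classification of real three-dimensional Lie algebras. -/
theorem exists_canonical {V : Type*} [AddCommGroup V] [Module ℝ V] (hV : Module.finrank ℝ V = 3)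
    (μ : LieBracket V) : ∃ g, Canonical g ∧ μ.Isomorphic g := by
  have : FiniteDimensional ℝ V := Module.finite_of_finrank_eq_succ hV
  let e := (Module.finBasisOfFinrankEq ℝ V hV).equivFun
  have h := μ.pullback_isomorphic e.symm
  obtain ⟨g, hg, hi⟩ := exists_canonical_R3 (μ.pullback e.symm)
  exact ⟨g, hg, h.symm.trans hi⟩

end LieBracket

/-! ### Continuity of the trace of ad and of the Killing form -/

namespace LieBracket

/-- The trace of `ad x`. -/
noncomputable def adTrace (g : LieBracket R3) (x : R3) : ℝ := LinearMap.trace ℝ R3 (g.bracket x)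

/-- The Killing form. -/
noncomputable def killing (g : LieBracket R3) (x y : R3) : ℝ :=
  LinearMap.trace ℝ R3 (g.bracket x ∘ₗ g.bracket y)

theorem trace_R3 (f : R3 →ₗ[ℝ] R3) :
    LinearMap.trace ℝ R3 f = f ![1, 0, 0] 0 + f ![0, 1, 0] 1 + f ![0, 0, 1] 2 := by
  have h0 : (Pi.single 0 1 : R3) = ![1, 0, 0] := by ext i; fin_cases i <;> rfl
  have h1 : (Pi.single 1 1 : R3) = ![0, 1, 0] := by ext i; fin_cases i <;> rfl
  have h2 : (Pi.single 2 1 : R3) = ![0, 0, 1] := by ext i; fin_cases i <;> rfl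
  rw [LinearMap.trace_eq_matrix_trace ℝ (Pi.basisFun ℝ (Fin 3)), Matrix.trace, Fin.sum_univ_three]
  simp [h0, h1, h2]

theorem adTrace_eq (g : LieBracket R3) (x : R3) : adTrace g x =
    g.bracket x ![1, 0, 0] 0 + g.bracket x ![0, 1, 0] 1 + g.bracket x ![0, 0, 1] 2 :=
  trace_R3 _

theorem killing_eq (g : LieBracket R3) (x y : R3) : killing g x y =
    g.bracket x (g.bracket y ![1, 0, 0]) 0 + g.bracket x (g.bracket y ![0, 1, 0]) 1
      + g.bracket x (g.bracket y ![0, 0, 1]) 2 :=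
  trace_R3 _

theorem adTrace_pullback (g : LieBracket R3) (e : R3 ≃ₗ[ℝ] R3) (x : R3) :
    adTrace (g.pullback e) x = adTrace g (e x) := by
  rw [adTrace, adTrace, ← LinearMap.trace_conj' (g.bracket (e x)) e.symm]
  congr 1

theorem killing_pullback (g : LieBracket R3) (e : R3 ≃ₗ[ℝ] R3) (x y : R3) :
    killing (g.pullback e) x y = killing g (e x) (e y) := by
  rw [killing, killing, ← LinearMap.trace_conj' (g.bracket (e x) ∘ₗ g.bracket (e y)) e.symm]
  congr 1
  refine LinearMap.ext fun z => ?_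
  simp [LinearEquiv.conj_apply]

theorem killing_self_eq_sum (g : LieBracket R3) (x : R3) :
    killing g x x = ∑ i, ∑ j, x i * x j * killing g (Pi.single i 1) (Pi.single j 1) := by
  have hx : x = x 0 • Pi.single 0 1 + x 1 • Pi.single 1 1 + x 2 • Pi.single 2 1 := by
    ext i; fin_cases i <;> simp
  conv_lhs => rw [hx]
  simp only [killing, map_add, map_smul, LinearMap.add_comp, LinearMap.comp_add,
    LinearMap.smul_comp, LinearMap.comp_smul, Fin.sum_univ_three, smul_eq_mul]
  ring

/-- The bracket is a polynomial in its structure constants and in the coordinates of its arguments,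
so all of them may vary at once. This is what lets iterated brackets pass to the limit. -/
theorem tendsto_bracket {ι : Type*} {l : Filter ι} {ν : ι → LieBracket R3} {g : LieBracket R3}
    (h : ∀ x y, Tendsto (fun i => (ν i).bracket x y) l (𝓝 (g.bracket x y))) {a b : ι → R3}
    {a₀ b₀ : R3} (ha : Tendsto a l (𝓝 a₀)) (hb : Tendsto b l (𝓝 b₀)) :
    Tendsto (fun i => (ν i).bracket (a i) (b i)) l (𝓝 (g.bracket a₀ b₀)) := by
  rw [tendsto_pi_nhds] at ha hb ⊢
  have h' := fun x y => tendsto_pi_nhds.1 (h x y)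
  intro k
  rw [g.bracket_eq_skew3, skew3_apply]
  have : (fun i => (ν i).bracket (a i) (b i) k) = fun i => _ := funext fun i => by
    rw [(ν i).bracket_eq_skew3, skew3_apply]
  rw [this]
  exact (((((ha 0).mul (hb 1)).sub ((ha 1).mul (hb 0))).mul (h' _ _ k)).add
    ((((ha 0).mul (hb 2)).sub ((ha 2).mul (hb 0))).mul (h' _ _ k))).add
    ((((ha 1).mul (hb 2)).sub ((ha 2).mul (hb 1))).mul (h' _ _ k))

/-- The algebra `g₀` is a limit of algebras isomorphic to `g`. -/
def Degenerates (g g₀ : LieBracket R3) : Prop :=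
  ∃ U : ℝ → (R3 ≃ₗ[ℝ] R3), ∀ x y,
    Tendsto (fun ε => (g.pullback (U ε)).bracket x y) (𝓝[>] 0) (𝓝 (g₀.bracket x y))

theorem Isomorphic.degenerates {g g₀ : LieBracket R3} (h : g.Isomorphic g₀) : Degenerates g g₀ := by
  obtain ⟨e, he⟩ := isomorphic_iff.1 h.symm
  refine ⟨fun _ => e, fun x y => ?_⟩
  simp [← he]

theorem tendsto_adTrace {ι : Type*} {l : Filter ι} {ν : ι → LieBracket R3} {g : LieBracket R3}
    (h : ∀ x y, Tendsto (fun i => (ν i).bracket x y) l (𝓝 (g.bracket x y))) (x : R3) :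
    Tendsto (fun i => adTrace (ν i) x) l (𝓝 (adTrace g x)) := by
  simp only [adTrace_eq]
  exact ((tendsto_pi_nhds.1 (h _ _) _).add (tendsto_pi_nhds.1 (h _ _) _)).add
    (tendsto_pi_nhds.1 (h _ _) _)

theorem tendsto_killing {ι : Type*} {l : Filter ι} {ν : ι → LieBracket R3} {g : LieBracket R3}
    (h : ∀ x y, Tendsto (fun i => (ν i).bracket x y) l (𝓝 (g.bracket x y))) (x y : R3) :
    Tendsto (fun i => killing (ν i) x y) l (𝓝 (killing g x y)) := by
  simp only [killing_eq]
  have h' : ∀ z k, Tendsto (fun i => (ν i).bracket x ((ν i).bracket y z) k) l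
      (𝓝 (g.bracket x (g.bracket y z) k)) := fun z k =>
    tendsto_pi_nhds.1 (tendsto_bracket h tendsto_const_nhds (h y z)) k
  exact ((h' _ _).add (h' _ _)).add (h' _ _)

/-! ### Closed conditions inherited by limits -/

namespace Degenerates

variable {g g₀ : LieBracket R3}

theorem abelian (h : Degenerates g g₀) (hg : ∀ x y, g.bracket x y = 0) (x y : R3) :
    g₀.bracket x y = 0 := by
  obtain ⟨U, hU⟩ := h
  refine tendsto_nhds_unique (hU x y) ?_
  simp [hg]

theorem two_step_nilpotent (h : Degenerates g g₀) (hg : ∀ x y z, g.bracket x (g.bracket y z) = 0)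
    (x y z : R3) : g₀.bracket x (g₀.bracket y z) = 0 := by
  obtain ⟨U, hU⟩ := h
  refine tendsto_nhds_unique (tendsto_bracket hU tendsto_const_nhds (hU y z)) ?_
  simp [hg]

theorem metabelian (h : Degenerates g g₀)
    (hg : ∀ x y z w, g.bracket (g.bracket x y) (g.bracket z w) = 0) (x y z w : R3) :
    g₀.bracket (g₀.bracket x y) (g₀.bracket z w) = 0 := by
  obtain ⟨U, hU⟩ := h
  refine tendsto_nhds_unique (tendsto_bracket hU (hU x y) (hU z w)) ?_
  simp [hg]

theorem bracket_eq_adTrace (h : Degenerates g g₀)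
    (hg : ∀ x y, (2 : ℝ) • g.bracket x y = adTrace g x • y - adTrace g y • x) (x y : R3) :
    (2 : ℝ) • g₀.bracket x y = adTrace g₀ x • y - adTrace g₀ y • x := by
  obtain ⟨U, hU⟩ := h
  refine tendsto_nhds_unique ((hU x y).const_smul (2 : ℝ)) ?_
  refine (((tendsto_adTrace hU x).smul_const y).sub
    ((tendsto_adTrace hU y).smul_const x)).congr fun ε => ?_
  rw [pullback_bracket, ← map_smul, hg, adTrace_pullback, adTrace_pullback]
  simp

/-- When (tr ad x)² and the Killing form are proportional, their ratio survives the limit.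
Cross-multiplication by α and β allows either side to vanish identically; α = 1, β = 0 expresses
unimodularity. -/
theorem adTrace_sq (h : Degenerates g g₀) {α β : ℝ}
    (hg : ∀ x, α * adTrace g x ^ 2 = β * killing g x x) (x : R3) :
    α * adTrace g₀ x ^ 2 = β * killing g₀ x x := by
  obtain ⟨U, hU⟩ := h
  refine tendsto_nhds_unique (((tendsto_adTrace hU x).pow 2).const_mul α) ?_
  refine ((tendsto_killing hU x x).const_mul β).congr fun ε => ?_
  rw [killing_pullback, adTrace_pullback, hg]

theorem killing_nonpos (h : Degenerates g g₀) (hg : ∀ x, killing g x x ≤ 0) (x : R3) :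
    killing g₀ x x ≤ 0 := by
  obtain ⟨U, hU⟩ := h
  exact le_of_tendsto' (tendsto_killing hU x x) fun ε => by rw [killing_pullback]; exact hg _

theorem killing_nonneg (h : Degenerates g g₀) (hg : ∀ x, 0 ≤ killing g x x) (x : R3) :
    0 ≤ killing g₀ x x := by
  obtain ⟨U, hU⟩ := h
  exact ge_of_tendsto' (tendsto_killing hU x x) fun ε => by rw [killing_pullback]; exact hg _

/-- The Killing form of so(3) is -2 times the standard form, so nearby forms are negative definite
too, while every algebra isomorphic to sl(2, ℝ) has a vector on which the Killing form equals 2. -/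
theorem not_sl2_so3 : ¬ Degenerates sl2 so3 := by
  rintro ⟨U, hU⟩
  have hk : ∀ i j : Fin 3, ∀ᶠ ε in 𝓝[>] (0 : ℝ),
      |killing (sl2.pullback (U ε)) (Pi.single i 1) (Pi.single j 1)
        - killing so3 (Pi.single i 1) (Pi.single j 1)| < 1 / 4 := fun i j => by
    have := (tendsto_killing hU (Pi.single i 1) (Pi.single j 1)).eventually
      (Metric.ball_mem_nhds _ (show (0 : ℝ) < 1 / 4 by norm_num))
    simpa [Metric.mem_ball, Real.dist_eq] using this
  obtain ⟨ε, hε⟩ := (eventually_all.2 fun i => eventually_all.2 (hk i)).exists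
  set x := (U ε).symm ![0, 1, 0] with hx
  have h2 : killing (sl2.pullback (U ε)) x x = 2 := by
    rw [killing_pullback, hx, LinearEquiv.apply_symm_apply, killing_eq]
    simp [sl2, skew3_apply]
    norm_num
  have h0 : killing so3 x x = -2 * (x 0 ^ 2 + x 1 ^ 2 + x 2 ^ 2) := by
    rw [killing_eq]
    simp [so3, skew3_apply]
    ring
  -- Entries within 1/4 of the limit change the form by at most (3/4)|x|², less than the available
  -- 2|x|².
  have hb : ∀ i j, x i * x j * (killing (sl2.pullback (U ε)) (Pi.single i 1) (Pi.single j 1)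
      - killing so3 (Pi.single i 1) (Pi.single j 1)) ≤ (x i ^ 2 + x j ^ 2) / 8 := fun i j => by
    have h1 := hε i j
    set d := killing (sl2.pullback (U ε)) (Pi.single i 1) (Pi.single j 1)
      - killing so3 (Pi.single i 1) (Pi.single j 1)
    obtain ⟨h1, h2⟩ := abs_lt.1 h1
    nlinarith [mul_nonneg (sq_nonneg (x i + x j)) (sub_nonneg.2 h2.le),
      mul_nonneg (sq_nonneg (x i - x j)) (sub_nonneg.2 h1.le)]
  have hs := Finset.sum_le_sum fun i (_ : i ∈ Finset.univ) =>
    Finset.sum_le_sum fun j (_ : j ∈ Finset.univ) => hb i j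
  simp only [mul_sub, Finset.sum_sub_distrib] at hs
  rw [← killing_self_eq_sum, ← killing_self_eq_sum, h2, h0] at hs
  simp only [Fin.sum_univ_three] at hs
  nlinarith [sq_nonneg (x 0), sq_nonneg (x 1), sq_nonneg (x 2)]

end Degenerates

end LieBracket

/-! ### Elimination of the pairs outside the list -/

namespace LieBracket

section Tables

variable (a b : ℝ) (x : R3)

theorem adTrace_A32 : adTrace A32 x = -2 * x 2 := by
  rw [adTrace_eq]; simp [A32, skew3_apply]; ring

theorem adTrace_A33 : adTrace A33 x = -2 * x 2 := by
  rw [adTrace_eq]; simp [A33, skew3_apply]; ring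

theorem adTrace_A34 : adTrace (A34 a) x = -(1 + a) * x 2 := by
  rw [adTrace_eq]; simp [A34, skew3_apply]; ring

theorem adTrace_A35 : adTrace (A35 b) x = -(2 * b) * x 2 := by
  rw [adTrace_eq]; simp [A35, skew3_apply]; ring

theorem adTrace_sl2 : adTrace sl2 x = 0 := by
  rw [adTrace_eq]; simp [sl2, skew3_apply]

theorem adTrace_so3 : adTrace so3 x = 0 := by
  rw [adTrace_eq]; simp [so3, skew3_apply]

theorem killing_A32 : killing A32 x x = 2 * x 2 ^ 2 := by
  rw [killing_eq]; simp [A32, skew3_apply]; ring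

theorem killing_A33 : killing A33 x x = 2 * x 2 ^ 2 := by
  rw [killing_eq]; simp [A33, skew3_apply]; ring

theorem killing_A34 : killing (A34 a) x x = (1 + a ^ 2) * x 2 ^ 2 := by
  rw [killing_eq]; simp [A34, skew3_apply]; ring

theorem killing_A35 : killing (A35 b) x x = 2 * (b ^ 2 - 1) * x 2 ^ 2 := by
  rw [killing_eq]; simp [A35, skew3_apply]; ring

theorem killing_so3 : killing so3 x x = -2 * (x 0 ^ 2 + x 1 ^ 2 + x 2 ^ 2) := by
  rw [killing_eq]; simp [so3, skew3_apply]; ring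

end Tables

theorem metabelian_of_skew3 {g : LieBracket R3} {q r : R3} (hg : g.bracket = skew3 0 q r)
    (hq : q 2 = 0) (hr : r 2 = 0) (x y z w : R3) :
    g.bracket (g.bracket x y) (g.bracket z w) = 0 := by
  ext i
  simp [hg, skew3_apply, hq, hr]

theorem A31_two_step_nilpotent (x y z : R3) : A31.bracket x (A31.bracket y z) = 0 := by
  ext i
  fin_cases i <;> simp [A31, skew3_apply]

theorem A33_bracket_eq_adTrace (x y : R3) :
    (2 : ℝ) • A33.bracket x y = adTrace A33 x • y - adTrace A33 y • x := by
  rw [adTrace_A33, adTrace_A33]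
  ext i
  fin_cases i <;> simp [A33, skew3_apply] <;> ring

namespace Degenerates

variable {g : LieBracket R3}

/-- The vectors [e₃, [e₃, e₁]] and [e₂, [e₂, e₁]] detect all the other canonical algebras. -/
theorem eq_A31_of_two_step_nilpotent (hg : Canonical g)
    (h : ∀ x y z, g.bracket x (g.bracket y z) = 0) : g = abelian3 ∨ g = A31 := by
  have h1 := h ![0, 0, 1] ![0, 0, 1] ![1, 0, 0]
  have h3 := congrFun h1 0
  have h4 := congrFun h1 1
  have h5 := congrFun (h ![0, 1, 0] ![0, 1, 0] ![1, 0, 0]) 0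
  cases hg with
  | abelian => exact .inl rfl
  | A31 => exact .inr rfl
  | A32 => simp [A32, skew3_apply] at h3
  | A33 => simp [A33, skew3_apply] at h3
  | A34 a => simp [A34, skew3_apply] at h3
  | A35 b =>
    simp [A35, skew3_apply] at h3 h4
    nlinarith
  | sl2 => simp [sl2, skew3_apply] at h5
  | so3 => simp [so3, skew3_apply] at h5

theorem ne_of_metabelian {g₀ : LieBracket R3}
    (h : ∀ x y z w, g₀.bracket (g₀.bracket x y) (g₀.bracket z w) = 0) : g₀ ≠ sl2 ∧ g₀ ≠ so3 := by
  constructor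
  · rintro rfl
    have := congrFun (h ![1, 0, 0] ![0, 1, 0] ![1, 0, 0] ![0, 0, 1]) 0
    simp [sl2, skew3_apply] at this
  · rintro rfl
    have := congrFun (h ![1, 0, 0] ![0, 1, 0] ![1, 0, 0] ![0, 0, 1]) 0
    simp [so3, skew3_apply] at this

end Degenerates

/-- Isomorphism to a pair in the list. -/
def IsListed (g g₀ : LieBracket R3) : Prop :=
  ∃ g' g₀' I k S, Listed g' g₀' I k S ∧ g.Isomorphic g' ∧ g₀.Isomorphic g₀'

theorem isListed_of_listed {g g₀ : LieBracket R3} {I k S} (h : Listed g g₀ I k S) :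
    IsListed g g₀ :=
  ⟨_, _, _, _, _, h, .refl _, .refl _⟩

theorem A34_listed_A31 {a : ℝ} (h₁ : -1 ≤ a) (h₂ : a < 1) : IsListed (A34 a) A31 := by
  by_cases ha : a = 0
  · subst ha
    exact ⟨_, _, _, _, _, .A21A1_A31, A34_zero_isomorphic_A21A1, .refl _⟩
  · exact isListed_of_listed (.A34_A31 a h₁ h₂ ha)

theorem Degenerates.isListed {g g₀ : LieBracket R3} (h : Degenerates g g₀) (hg : Canonical g)
    (hg₀ : Canonical g₀) (hne : g ≠ g₀) (h0 : g₀ ≠ abelian3) : IsListed g g₀ := by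
  cases hg with
  | abelian =>
    have := h.abelian (by simp [abelian3])
    rcases eq_A31_of_two_step_nilpotent hg₀ (by simp [this]) with rfl | rfl
    · exact absurd rfl h0
    · have := congrFun (this ![0, 1, 0] ![0, 0, 1]) 0
      simp [A31, skew3_apply] at this
  | A31 =>
    rcases eq_A31_of_two_step_nilpotent hg₀ (h.two_step_nilpotent A31_two_step_nilpotent)
      with rfl | rfl
    · exact absurd rfl h0
    · exact absurd rfl hne
  | A32 =>
    obtain ⟨hs, hs'⟩ := ne_of_metabelian (h.metabelian (metabelian_of_skew3 rfl rfl rfl))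
    have ht := h.adTrace_sq (α := 1) (β := 2) (fun x => by rw [adTrace_A32, killing_A32]; ring)
      ![0, 0, 1]
    cases hg₀ with
    | abelian => exact absurd rfl h0
    | A31 => exact isListed_of_listed .A32_A31
    | A32 => exact absurd rfl hne
    | A33 => exact isListed_of_listed .A32_A33
    | A34 a h₁ h₂ =>
      simp [adTrace_A34, killing_A34] at ht
      nlinarith [sq_pos_of_pos (sub_pos.2 h₂)]
    | A35 b hb =>
      simp [adTrace_A35, killing_A35] at ht
      nlinarith
    | sl2 => exact absurd rfl hs
    | so3 => exact absurd rfl hs'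
  | A33 =>
    obtain ⟨hs, hs'⟩ := ne_of_metabelian (h.metabelian (metabelian_of_skew3 rfl rfl rfl))
    have ht := h.bracket_eq_adTrace A33_bracket_eq_adTrace
    cases hg₀ with
    | abelian => exact absurd rfl h0
    | A31 =>
      have := congrFun (ht ![0, 1, 0] ![0, 0, 1]) 0
      simp [A31, skew3_apply] at this
    | A32 =>
      have := congrFun (ht ![0, 1, 0] ![0, 0, 1]) 0
      simp [A32, skew3_apply] at this
    | A33 => exact absurd rfl hne
    | A34 a h₁ h₂ =>
      have h1 := congrFun (ht ![0, 1, 0] ![0, 0, 1]) 1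
      have h2 := congrFun (ht ![1, 0, 0] ![0, 0, 1]) 0
      simp [adTrace_A34] at h1 h2
      simp [A34, skew3_apply] at h1 h2
      linarith
    | A35 b hb =>
      have h1 := congrFun (ht ![0, 1, 0] ![0, 0, 1]) 0
      simp [A35, skew3_apply] at h1
    | sl2 => exact absurd rfl hs
    | so3 => exact absurd rfl hs'
  | A34 a ha₁ ha₂ =>
    obtain ⟨hs, hs'⟩ := ne_of_metabelian (h.metabelian (metabelian_of_skew3 rfl rfl rfl))
    have ht := h.adTrace_sq (α := 1 + a ^ 2) (β := (1 + a) ^ 2)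
      (fun x => by rw [adTrace_A34, killing_A34]; ring) ![0, 0, 1]
    have hk := h.killing_nonneg (fun x => by rw [killing_A34]; positivity) ![0, 0, 1]
    have ha := sq_pos_of_pos (sub_pos.2 ha₂)
    cases hg₀ with
    | abelian => exact absurd rfl h0
    | A31 => exact A34_listed_A31 ha₁ ha₂
    | A32 =>
      simp [adTrace_A32, killing_A32] at ht
      nlinarith
    | A33 =>
      simp [adTrace_A33, killing_A33] at ht
      nlinarith
    | A34 b hb₁ hb₂ =>
      simp [adTrace_A34, killing_A34] at ht
      -- The ratio determines the parameter only up to inversion; within [-1, 1), a b = 1 forces a =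
      -- b = -1.
      have : (a - b) * (1 - a * b) = 0 := by linear_combination (-1 / 2) * ht
      rcases mul_eq_zero.1 this with h' | h'
      · exact absurd (by rw [sub_eq_zero.1 h']) hne
      · obtain rfl : a = -1 := by nlinarith
        obtain rfl : b = -1 := by linarith
        exact absurd rfl hne
    | A35 b hb =>
      simp [adTrace_A35, killing_A35] at ht hk
      rw [abs_of_nonneg hb] at hk
      have hb2 : 0 < b ^ 2 * (1 - a) ^ 2 := by positivity
      nlinarith [sq_nonneg (1 + a)]
    | sl2 => exact absurd rfl hs
    | so3 => exact absurd rfl hs'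
  | A35 b hb =>
    obtain ⟨hs, hs'⟩ := ne_of_metabelian (h.metabelian (metabelian_of_skew3 rfl rfl rfl))
    have ht := h.adTrace_sq (α := b ^ 2 - 1) (β := 2 * b ^ 2)
      (fun x => by rw [adTrace_A35, killing_A35]; ring) ![0, 0, 1]
    cases hg₀ with
    | abelian => exact absurd rfl h0
    | A31 => exact isListed_of_listed (.A35_A31 b hb)
    | A32 =>
      simp [adTrace_A32, killing_A32] at ht
      linarith
    | A33 =>
      simp [adTrace_A33, killing_A33] at ht
      linarith
    | A34 a ha₁ ha₂ =>
      simp [adTrace_A34, killing_A34] at ht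
      have hb0 : b = 0 := by
        have : b ^ 2 * (1 - a) ^ 2 + (1 + a) ^ 2 = 0 := by linear_combination -ht
        have h1 : b ^ 2 * (1 - a) ^ 2 = 0 := by
          nlinarith [sq_nonneg (1 + a), sq_nonneg (b * (1 - a))]
        have h2 : (1 - a) ^ 2 ≠ 0 := pow_ne_zero _ (sub_pos.2 ha₂).ne'
        simpa [h2] using h1
      subst hb0
      -- For b = 0 the ratio leaves only a = -1, and the sign of the Killing form rules this out.
      have hk := h.killing_nonpos (fun x => by rw [killing_A35]; nlinarith [sq_nonneg (x 2)])
        ![0, 0, 1]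
      simp [killing_A34] at hk
      nlinarith
    | A35 b' hb' =>
      simp [adTrace_A35, killing_A35] at ht
      have : b ^ 2 = b' ^ 2 := by linear_combination (1 / 4) * ht
      exact absurd (by rw [(pow_left_inj₀ hb hb' two_ne_zero).1 this]) hne
    | sl2 => exact absurd rfl hs
    | so3 => exact absurd rfl hs'
  | sl2 =>
    have ht := h.adTrace_sq (α := 1) (β := 0) (fun x => by rw [adTrace_sl2]; ring) ![0, 0, 1]
    cases hg₀ with
    | abelian => exact absurd rfl h0
    | A31 => exact isListed_of_listed .sl2_A31
    | A32 => simp [adTrace_A32] at ht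
    | A33 => simp [adTrace_A33] at ht
    | A34 a ha₁ ha₂ =>
      simp [adTrace_A34] at ht
      obtain rfl : a = -1 := by linarith
      exact isListed_of_listed .sl2_A34
    | A35 b hb =>
      simp [adTrace_A35] at ht
      subst ht
      exact isListed_of_listed .sl2_A35
    | sl2 => exact absurd rfl hne
    | so3 => exact absurd h not_sl2_so3
  | so3 =>
    have ht := h.adTrace_sq (α := 1) (β := 0) (fun x => by rw [adTrace_so3]; ring) ![0, 0, 1]
    have hk := h.killing_nonpos fun x => by
      rw [killing_so3]
      nlinarith [sq_nonneg (x 0), sq_nonneg (x 1), sq_nonneg (x 2)]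
    cases hg₀ with
    | abelian => exact absurd rfl h0
    | A31 => exact isListed_of_listed .so3_A31
    | A32 => simp [adTrace_A32] at ht
    | A33 => simp [adTrace_A33] at ht
    | A34 a ha₁ ha₂ =>
      have := hk ![0, 0, 1]
      simp [killing_A34] at this
      nlinarith
    | A35 b hb =>
      simp [adTrace_A35] at ht
      subst ht
      exact isListed_of_listed .so3_A35
    | sl2 =>
      have := hk ![0, 1, 0]
      rw [killing_eq] at this
      simp [sl2, skew3_apply] at this
      linarith
    | so3 => exact absurd rfl hne

theorem _root_.Listed.not_isomorphic {g g₀ : LieBracket R3} {I k S} (h : Listed g g₀ I k S) :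
    ¬ g.Isomorphic g₀ := by
  intro hi
  -- An isomorphism would make g a limit of g₀, so the identities of g₀ would hold in g.
  have hd := hi.symm.degenerates
  cases h with
  | A21A1_A31 =>
    have := congrFun (hd.two_step_nilpotent A31_two_step_nilpotent
      ![0, 1, 0] ![0, 1, 0] ![1, 0, 0]) 0
    simp [A21A1, skew3_apply] at this
  | A32_A31 | A32_A31_diag =>
    rcases Degenerates.eq_A31_of_two_step_nilpotent .A32
      (hd.two_step_nilpotent A31_two_step_nilpotent) with h | h
    all_goals
      have := congrArg (fun g => g.bracket ![1, 0, 0] ![0, 0, 1] 0) h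
      simp [A32, A31, abelian3, skew3_apply] at this
  | A32_A33 | A32_A33_diag =>
    have := congrFun (hd.bracket_eq_adTrace A33_bracket_eq_adTrace ![0, 1, 0] ![0, 0, 1]) 0
    simp [A32, skew3_apply] at this
  | A34_A31 a =>
    have := congrFun (hd.two_step_nilpotent A31_two_step_nilpotent
      ![0, 0, 1] ![0, 0, 1] ![1, 0, 0]) 0
    simp [A34, skew3_apply] at this
  | A35_A31 b =>
    have := hd.two_step_nilpotent A31_two_step_nilpotent ![0, 0, 1] ![0, 0, 1] ![1, 0, 0]
    have h1 := congrFun this 0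
    have h2 := congrFun this 1
    simp [A35, skew3_apply] at h1 h2
    nlinarith
  | sl2_A31 =>
    exact (Degenerates.ne_of_metabelian
      (hd.metabelian (metabelian_of_skew3 rfl rfl rfl))).1 rfl
  | sl2_A34 =>
    exact (Degenerates.ne_of_metabelian
      (hd.metabelian (metabelian_of_skew3 rfl rfl rfl))).1 rfl
  | sl2_A35 =>
    exact (Degenerates.ne_of_metabelian
      (hd.metabelian (metabelian_of_skew3 rfl rfl rfl))).1 rfl
  | so3_A31 =>
    exact (Degenerates.ne_of_metabelian
      (hd.metabelian (metabelian_of_skew3 rfl rfl rfl))).2 rfl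
  | so3_A35 =>
    exact (Degenerates.ne_of_metabelian
      (hd.metabelian (metabelian_of_skew3 rfl rfl rfl))).2 rfl

end LieBracket

/-! ### Transport of contractions; constant and dilation contractions -/

namespace Contraction

variable {V W : Type*} [NormedAddCommGroup V] [NormedSpace ℝ V] [NormedAddCommGroup W]
  [NormedSpace ℝ W]

/-- A contraction on `W` transported to `V`. -/
noncomputable def transport (C : Contraction W) (e : V ≃L[ℝ] W) : Contraction V where
  source := C.source.pullback e.toLinearEquiv
  target := C.target.pullback e.toLinearEquiv
  U ε := (e.trans (C.U ε)).trans e.symm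
  continuousOn := (continuousOn_const (c := (e.symm : W →L[ℝ] V))).clm_comp
    (C.continuousOn.clm_comp (continuousOn_const (c := (e : V →L[ℝ] W))))
  tendsto x y := by
    have h := (e.symm.continuous.tendsto _).comp (C.tendsto (e x) (e y))
    simpa [Function.comp_def] using h

theorem transport_isDiagonalized {C : Contraction W} (e : V ≃L[ℝ] W) {n : ℕ}
    {b b' : Module.Basis (Fin n) ℝ W} {d : ℝ → Fin n → ℝ} (h : C.IsDiagonalized b b' d) :
    (C.transport e).IsDiagonalized (b.map e.symm.toLinearEquiv)
      (b'.map e.symm.toLinearEquiv) d := by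
  intro ε hε i
  simp [transport, h ε hε i]

theorem transport_isGeneralizedIW {C : Contraction W} (e : V ≃L[ℝ] W) {n : ℕ} {α : Fin n → ℤ}
    (h : C.IsGeneralizedIW α) : (C.transport e).IsGeneralizedIW α :=
  let ⟨_, _, h⟩ := h
  ⟨_, _, transport_isDiagonalized e h⟩

theorem transport_isSimpleIW {C : Contraction W} (e : V ≃L[ℝ] W) (h : C.IsSimpleIW) :
    (C.transport e).IsSimpleIW :=
  let ⟨_, _, _, _, _, _, h, _⟩ := h
  ⟨_, _, _, _, _, _, transport_isDiagonalized e h, rfl⟩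

theorem transport_source_isomorphic (C : Contraction W) (e : V ≃L[ℝ] W) :
    (C.transport e).source.Isomorphic C.source :=
  LieBracket.pullback_isomorphic _ _

theorem transport_target_isomorphic (C : Contraction W) (e : V ≃L[ℝ] W) :
    (C.transport e).target.Isomorphic C.target :=
  LieBracket.pullback_isomorphic _ _

/-- The constant contraction of an algebra to itself. -/
def const (μ : LieBracket V) : Contraction V where
  source := μ
  target := μ
  U _ := ContinuousLinearEquiv.refl ℝ V
  continuousOn := continuousOn_const
  tendsto x y := by simp

theorem const_isDiagonalized (μ : LieBracket V) {n : ℕ} (b : Module.Basis (Fin n) ℝ V) :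
    (const μ).IsDiagonalized b b (fun _ _ => 1) := by
  intro ε _ i
  simp [const]

/-- The contraction of an algebra to the Abelian algebra by the dilations `ε`. -/
noncomputable def trivial (μ : LieBracket V) {ν : LieBracket V} (hν : ∀ x y, ν.bracket x y = 0) :
    Contraction V where
  source := μ
  target := ν
  U ε := if h : ε = 0 then ContinuousLinearEquiv.refl ℝ V else
    ContinuousLinearEquiv.smulLeft (Units.mk0 ε h)
  continuousOn := by
    refine ContinuousOn.congr (f := fun ε : ℝ => ε • ContinuousLinearMap.id ℝ V)
      (continuous_id.smul continuous_const).continuousOn fun ε hε => ?_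
    ext x
    simp [hε.1.ne', Units.smul_def]
  tendsto x y := by
    rw [hν]
    have h : Tendsto (fun ε : ℝ => ε • μ.bracket x y) (𝓝[>] 0) (𝓝 ((0 : ℝ) • μ.bracket x y)) :=
      tendsto_nhdsWithin_of_tendsto_nhds (tendsto_id.smul_const _)
    rw [zero_smul] at h
    refine h.congr' ?_
    filter_upwards [self_mem_nhdsWithin] with ε hε
    have h0 : ε ≠ 0 := (mem_Ioi.1 hε).ne'
    have hs : (ContinuousLinearEquiv.smulLeft (Units.mk0 ε h0) : V ≃L[ℝ] V).symm
        (ε • ε • μ.bracket x y) = ε • μ.bracket x y := by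
      rw [ContinuousLinearEquiv.symm_apply_eq]
      simp [Units.smul_def]
    simpa [h0, Units.smul_def] using hs.symm

theorem trivial_isDiagonalized (μ : LieBracket V) {ν : LieBracket V}
    (hν : ∀ x y, ν.bracket x y = 0) {n : ℕ} (b : Module.Basis (Fin n) ℝ V) :
    (trivial μ hν).IsDiagonalized b b (fun ε _ => ε) := by
  intro ε hε i
  simp [trivial, hε.1.ne', Units.smul_def]

theorem degenerates (C : Contraction V) {g g₀ : LieBracket R3} (e : V ≃ₗ[ℝ] R3)
    (he : ∀ x y, e (C.source.bracket x y) = g.bracket (e x) (e y)) (f : V ≃ₗ[ℝ] R3)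
    (hf : ∀ x y, f (C.target.bracket x y) = g₀.bracket (f x) (f y)) (x y : R3) :
    Tendsto (fun ε => (g.pullback ((f.symm.trans (C.U ε).toLinearEquiv).trans e)).bracket x y)
      (𝓝[>] 0) (𝓝 (g₀.bracket x y)) := by
  have : FiniteDimensional ℝ V := f.symm.finiteDimensional
  have h := (f.toLinearMap.continuous_of_finiteDimensional.tendsto _).comp
    (C.tendsto (f.symm x) (f.symm y))
  simpa [Function.comp_def, hf, ← he] using h

end Contraction

/-! ### Contractions given by matrices -/

section MatrixContractions

/-- The contraction matrix `I · diag(ε ^ k₁, ε ^ k₂, ε ^ k₃)`. -/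
noncomputable def contractionMatrix (I : Matrix (Fin 3) (Fin 3) ℝ) (k : Fin 3 → ℤ) (ε : ℝ) :
    Matrix (Fin 3) (Fin 3) ℝ :=
  I * Matrix.diagonal fun i => ε ^ k i

theorem contractionMatrix_apply (I : Matrix (Fin 3) (Fin 3) ℝ) (k : Fin 3 → ℤ) (ε : ℝ)
    (i j : Fin 3) : contractionMatrix I k ε i j = I i j * ε ^ k j :=
  Matrix.mul_diagonal _ _ _ _

theorem det_contractionMatrix_ne_zero {I : Matrix (Fin 3) (Fin 3) ℝ} (hI : I.det ≠ 0)
    (k : Fin 3 → ℤ) {ε : ℝ} (hε : 0 < ε) : (contractionMatrix I k ε).det ≠ 0 := by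
  rw [contractionMatrix, Matrix.det_mul, Matrix.det_diagonal]
  exact mul_ne_zero hI (Finset.prod_ne_zero_iff.2 fun i _ => zpow_ne_zero _ hε.ne')

/-- The linear automorphism of `R3` given by a matrix (the identity if the matrix is singular). -/
noncomputable def matrixEquiv (A : Matrix (Fin 3) (Fin 3) ℝ) : R3 ≃L[ℝ] R3 :=
  open Classical in
  if h : A.det ≠ 0 then
    (Matrix.toLin'OfInv (M := A⁻¹) (M' := A) (Matrix.nonsing_inv_mul A (isUnit_iff_ne_zero.2 h))
      (Matrix.mul_nonsing_inv A (isUnit_iff_ne_zero.2 h))).toContinuousLinearEquiv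
  else ContinuousLinearEquiv.refl ℝ R3

theorem matrixEquiv_apply {A : Matrix (Fin 3) (Fin 3) ℝ} (hA : A.det ≠ 0) (x : R3) :
    matrixEquiv A x = A.mulVec x := by
  rw [matrixEquiv, dif_pos hA]
  simp [Matrix.toLin'OfInv]

theorem continuousOn_matrixEquiv {I : Matrix (Fin 3) (Fin 3) ℝ} (hI : I.det ≠ 0)
    (k : Fin 3 → ℤ) :
    ContinuousOn (fun ε => (matrixEquiv (contractionMatrix I k ε) : R3 →L[ℝ] R3)) (Ioc 0 1) := by
  let L : Matrix (Fin 3) (Fin 3) ℝ →ₗ[ℝ] (R3 →L[ℝ] R3) :=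
    (LinearMap.toContinuousLinearMap (𝕜 := ℝ) (E := R3) (F' := R3)).toLinearMap ∘ₗ
      (Matrix.toLin' (R := ℝ) (m := Fin 3) (n := Fin 3)).toLinearMap
  have hL : Continuous L := L.continuous_of_finiteDimensional
  have hM : ContinuousOn (contractionMatrix I k) (Ioc 0 1) := by
    refine continuousOn_const.mul ?_
    refine (Continuous.matrix_diagonal continuous_id).comp_continuousOn
      (continuousOn_pi.2 fun i => ?_)
    exact continuousOn_id.zpow₀ _ fun ε hε => .inl hε.1.ne'
  refine (hL.comp_continuousOn hM).congr fun ε hε => ?_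
  ext1 x
  exact matrixEquiv_apply (det_contractionMatrix_ne_zero hI k hε.1) x

/-- Here p, q, r are the structure constants of the transformed bracket. The intertwining hypothesis
avoids computing an inverse matrix, and the limit becomes continuity of p, q, r at 0. -/
theorem exists_contraction {g g₀ : LieBracket R3} {I : Matrix (Fin 3) (Fin 3) ℝ} {k : Fin 3 → ℤ}
    (hI : I.det ≠ 0) (p q r : ℝ → R3) (hp : Continuous p) (hq : Continuous q) (hr : Continuous r)
    (h₀ : g₀.bracket = skew3 (p 0) (q 0) (r 0))
    (h : ∀ ε, 0 < ε → ∀ x y, g.bracket ((contractionMatrix I k ε).mulVec x)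
      ((contractionMatrix I k ε).mulVec y)
        = (contractionMatrix I k ε).mulVec (skew3 (p ε) (q ε) (r ε) x y)) :
    ∃ C : Contraction R3, C.source = g ∧ C.target = g₀ ∧
      ∀ ε ∈ Ioc (0 : ℝ) 1, ∀ x : R3, C.U ε x = (contractionMatrix I k ε).mulVec x := by
  refine ⟨⟨g, g₀, fun ε => matrixEquiv (contractionMatrix I k ε), continuousOn_matrixEquiv hI k,
    fun x y => ?_⟩, rfl, rfl, fun ε hε x =>
    matrixEquiv_apply (det_contractionMatrix_ne_zero hI k hε.1) x⟩
  have hc : Continuous fun ε => skew3 (p ε) (q ε) (r ε) x y := by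
    refine continuous_pi fun i => ?_
    simp only [skew3_apply]
    fun_prop
  rw [h₀]
  refine (tendsto_nhdsWithin_of_tendsto_nhds (hc.tendsto 0)).congr' ?_
  filter_upwards [self_mem_nhdsWithin] with ε hε
  have hd := det_contractionMatrix_ne_zero hI k (mem_Ioi.1 hε)
  rw [matrixEquiv_apply hd, matrixEquiv_apply hd, h ε hε, ContinuousLinearEquiv.eq_symm_apply,
    matrixEquiv_apply hd]

/-- The basis formed by the columns of a nonsingular matrix. -/
noncomputable def columnBasis (I : Matrix (Fin 3) (Fin 3) ℝ) (hI : I.det ≠ 0) :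
    Module.Basis (Fin 3) ℝ R3 :=
  basisOfLinearIndependentOfCardEqFinrank (b := I.col)
    (Matrix.linearIndependent_cols_iff_isUnit.2
      ((Matrix.isUnit_iff_isUnit_det I).2 (isUnit_iff_ne_zero.2 hI))) (by simp)

/-- The two bases are the columns of I and the standard basis. The permutation σ is there because a
simple Inönü–Wigner contraction requires its first block to come first. -/
theorem isDiagonalized_of_matrix {C : Contraction R3} {I : Matrix (Fin 3) (Fin 3) ℝ}
    {k : Fin 3 → ℤ} (hI : I.det ≠ 0)
    (hU : ∀ ε ∈ Ioc (0 : ℝ) 1, ∀ x : R3, C.U ε x = (contractionMatrix I k ε).mulVec x)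
    (σ : Equiv.Perm (Fin 3)) :
    C.IsDiagonalized ((columnBasis I hI).reindex σ) ((Pi.basisFun ℝ (Fin 3)).reindex σ)
      (fun ε i => ε ^ k (σ.symm i)) := by
  intro ε hε i
  rw [hU ε hε, contractionMatrix]
  ext j
  simp [columnBasis, mul_comm]

theorem isSimpleIWAlong_of_matrix {C : Contraction R3} {I : Matrix (Fin 3) (Fin 3) ℝ}
    {k : Fin 3 → ℤ} (hI : I.det ≠ 0)
    (hU : ∀ ε ∈ Ioc (0 : ℝ) 1, ∀ x : R3, C.U ε x = (contractionMatrix I k ε).mulVec x)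
    (σ : Equiv.Perm (Fin 3)) (s : ℕ) (hk : ∀ i, k (σ.symm i) = if (i : ℕ) < s then 0 else 1) :
    C.IsSimpleIWAlong (Submodule.span ℝ {x | ∃ i : Fin 3, (i : ℕ) < s ∧ x = I.col (σ.symm i)}) := by
  -- With v = 0 the first block is constantly 1, matching the exponent 0.
  refine ⟨3, s, 0, (columnBasis I hI).reindex σ, (Pi.basisFun ℝ (Fin 3)).reindex σ,
    fun ε hε i => ?_, ?_⟩
  · rw [isDiagonalized_of_matrix hI hU σ ε hε i]
    simp only [hk]
    split_ifs <;> simp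
  · simp [columnBasis]

end MatrixContractions

/-! ### Verification of the listed limits -/

namespace Listed

variable {g g₀ : LieBracket R3} {I : Matrix (Fin 3) (Fin 3) ℝ} {k : Fin 3 → ℤ}
  {S : Option (Submodule ℝ R3)}

theorem det_ne_zero (h : Listed g g₀ I k S) : I.det ≠ 0 := by
  cases h with
  | A34_A31 a h₁ h₂ =>
    simp [Matrix.det_fin_three, sub_eq_zero, h₂.ne']
  | _ => simp [Matrix.det_fin_three]

theorem nonneg (h : Listed g g₀ I k S) (i : Fin 3) : 0 ≤ k i := by
  cases h <;> fin_cases i <;> simp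

theorem not_abelian (h : Listed g g₀ I k S) : g₀.bracket ![0, 1, 0] ![0, 0, 1] ≠ 0 := by
  intro h0
  have h1 := congrFun h0 0
  have h2 := congrFun h0 1
  cases h <;> simp [A31, A33, A34, A35, skew3_apply] at h1 h2

theorem exists_contraction (h : Listed g g₀ I k S) :
    ∃ C : Contraction R3, C.source = g ∧ C.target = g₀ ∧
      ∀ ε ∈ Ioc (0 : ℝ) 1, ∀ x : R3, C.U ε x = (contractionMatrix I k ε).mulVec x := by
  have key : ∀ p q r : ℝ → Fin 3 → ℝ, (∀ i, Continuous fun ε => p ε i) →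
      (∀ i, Continuous fun ε => q ε i) → (∀ i, Continuous fun ε => r ε i) →
      (∀ x y i, g₀.bracket x y i = skew3 (p 0) (q 0) (r 0) x y i) →
      (∀ ε, 0 < ε → ∀ x y, g.bracket ((contractionMatrix I k ε).mulVec x)
        ((contractionMatrix I k ε).mulVec y)
          = (contractionMatrix I k ε).mulVec (skew3 (p ε) (q ε) (r ε) x y)) → _ :=
    fun p q r hp hq hr h₀ => _root_.exists_contraction h.det_ne_zero p q r
      (continuous_pi hp) (continuous_pi hq) (continuous_pi hr)
      (LinearMap.ext fun x => LinearMap.ext fun y => funext (h₀ x y))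
  -- In each case the three functions are the coordinates of U_ε⁻¹[U_ε eᵢ, U_ε eⱼ] for (i, j) = (1,
  -- 2), (1, 3), (2, 3).
  cases h
  case A21A1_A31 =>
    refine key (fun ε => ![ε, 0, 0]) (fun ε => ![0, 0, 0]) (fun ε => ![1, 0, 0])
      (fun i => by fin_cases i <;> simp <;> fun_prop)
      (fun i => by fin_cases i <;> simp <;> fun_prop)
      (fun i => by fin_cases i <;> simp <;> fun_prop) (fun x y i => ?_) fun ε hε x y => ?_
    · fin_cases i <;> simp [A31, skew3_apply]
    · ext i
      fin_cases i <;>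
        simp [contractionMatrix_apply, Matrix.mulVec, dotProduct, Fin.sum_univ_three,
          skew3_apply, A21A1]
        <;> ring
  case A32_A31 =>
    refine key (fun ε => ![0, 0, 0]) (fun ε => ![-ε, 0, 0]) (fun ε => ![1, -ε, 0])
      (fun i => by fin_cases i <;> simp <;> fun_prop)
      (fun i => by fin_cases i <;> simp <;> fun_prop)
      (fun i => by fin_cases i <;> simp <;> fun_prop) (fun x y i => ?_) fun ε hε x y => ?_
    · fin_cases i <;> simp [A31, skew3_apply]
    · ext i
      fin_cases i <;>
        simp [contractionMatrix_apply, Matrix.mulVec, dotProduct, Fin.sum_univ_three,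
          skew3_apply, A32]
        <;> ring
  case A32_A31_diag =>
    refine key (fun ε => ![0, 0, 0]) (fun ε => ![ε, 0, 0]) (fun ε => ![1, ε, 0])
      (fun i => by fin_cases i <;> simp <;> fun_prop)
      (fun i => by fin_cases i <;> simp <;> fun_prop)
      (fun i => by fin_cases i <;> simp <;> fun_prop) (fun x y i => ?_) fun ε hε x y => ?_
    · fin_cases i <;> simp [A31, skew3_apply]
    · ext i
      fin_cases i <;>
        simp [contractionMatrix_apply, Matrix.mulVec, dotProduct, Fin.sum_univ_three,
          skew3_apply, A32]
        <;> ring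
  case A32_A33 =>
    refine key (fun ε => ![0, 0, 0]) (fun ε => ![1, 0, 0]) (fun ε => ![ε, 1, 0])
      (fun i => by fin_cases i <;> simp <;> fun_prop)
      (fun i => by fin_cases i <;> simp <;> fun_prop)
      (fun i => by fin_cases i <;> simp <;> fun_prop) (fun x y i => ?_) fun ε hε x y => ?_
    · fin_cases i <;> simp [A33, skew3_apply]
    · ext i
      fin_cases i <;>
        simp [contractionMatrix_apply, Matrix.mulVec, dotProduct, Fin.sum_univ_three,
          skew3_apply, A32]
        <;> ring
  case A32_A33_diag =>
    refine key (fun ε => ![0, 0, 0]) (fun ε => ![1, 0, 0]) (fun ε => ![ε, 1, 0])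
      (fun i => by fin_cases i <;> simp <;> fun_prop)
      (fun i => by fin_cases i <;> simp <;> fun_prop)
      (fun i => by fin_cases i <;> simp <;> fun_prop) (fun x y i => ?_) fun ε hε x y => ?_
    · fin_cases i <;> simp [A33, skew3_apply]
    · ext i
      fin_cases i <;>
        simp [contractionMatrix_apply, Matrix.mulVec, dotProduct, Fin.sum_univ_three,
          skew3_apply, A32]
        <;> ring
  case A34_A31 a _ _ _ =>
    refine key (fun ε => ![0, 0, 0]) (fun ε => ![ε, 0, 0]) (fun ε => ![1, ε * a, 0])
      (fun i => by fin_cases i <;> simp <;> fun_prop)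
      (fun i => by fin_cases i <;> simp <;> fun_prop)
      (fun i => by fin_cases i <;> simp <;> fun_prop) (fun x y i => ?_) fun ε hε x y => ?_
    · fin_cases i <;> simp [A31, skew3_apply]
    · ext i
      fin_cases i <;>
        simp [contractionMatrix_apply, Matrix.mulVec, dotProduct, Fin.sum_univ_three,
          skew3_apply, A34]
        <;> ring
  case A35_A31 b _ =>
    refine key (fun ε => ![0, 0, 0]) (fun ε => ![ε * b, -ε ^ 2, 0]) (fun ε => ![1, ε * b, 0])
      (fun i => by fin_cases i <;> simp <;> fun_prop)
      (fun i => by fin_cases i <;> simp <;> fun_prop)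
      (fun i => by fin_cases i <;> simp <;> fun_prop) (fun x y i => ?_) fun ε hε x y => ?_
    · fin_cases i <;> simp [A31, skew3_apply]
    · ext i
      fin_cases i <;>
        simp [contractionMatrix_apply, Matrix.mulVec, dotProduct, Fin.sum_univ_three,
          skew3_apply, A35]
        <;> ring
  case sl2_A31 =>
    refine key (fun ε => ![0, -2 * ε, 0]) (fun ε => ![0, 0, 2 * ε]) (fun ε => ![1, 0, 0])
      (fun i => by fin_cases i <;> simp <;> fun_prop)
      (fun i => by fin_cases i <;> simp <;> fun_prop)
      (fun i => by fin_cases i <;> simp <;> fun_prop) (fun x y i => ?_) fun ε hε x y => ?_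
    · fin_cases i <;> simp [A31, skew3_apply]
    · ext i
      fin_cases i <;>
        simp [contractionMatrix_apply, Matrix.mulVec, dotProduct, Fin.sum_univ_three,
          skew3_apply, sl2]
        <;> ring
  case sl2_A34 =>
    refine key (fun ε => ![0, 0, -2 * ε]) (fun ε => ![1, 0, 0]) (fun ε => ![0, -1, 0])
      (fun i => by fin_cases i <;> simp <;> fun_prop)
      (fun i => by fin_cases i <;> simp <;> fun_prop)
      (fun i => by fin_cases i <;> simp <;> fun_prop) (fun x y i => ?_) fun ε hε x y => ?_
    · fin_cases i <;> simp [A34, skew3_apply]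
    · ext i
      fin_cases i <;>
        simp [contractionMatrix_apply, Matrix.mulVec, dotProduct, Fin.sum_univ_three,
          skew3_apply, sl2]
        <;> ring
  case sl2_A35 =>
    refine key (fun ε => ![-ε, 0, 0]) (fun ε => ![0, -1, 0]) (fun ε => ![1, 0, -ε])
      (fun i => by fin_cases i <;> simp <;> fun_prop)
      (fun i => by fin_cases i <;> simp <;> fun_prop)
      (fun i => by fin_cases i <;> simp <;> fun_prop) (fun x y i => ?_) fun ε hε x y => ?_
    · fin_cases i <;> simp [A35, skew3_apply]
    · ext i
      fin_cases i <;>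
        simp [contractionMatrix_apply, Matrix.mulVec, dotProduct, Fin.sum_univ_three,
          skew3_apply, sl2]
        <;> ring
  case so3_A31 =>
    refine key (fun ε => ![0, 0, ε ^ 2]) (fun ε => ![0, -ε ^ 2, 0]) (fun ε => ![1, 0, 0])
      (fun i => by fin_cases i <;> simp <;> fun_prop)
      (fun i => by fin_cases i <;> simp <;> fun_prop)
      (fun i => by fin_cases i <;> simp <;> fun_prop) (fun x y i => ?_) fun ε hε x y => ?_
    · fin_cases i <;> simp [A31, skew3_apply]
    · ext i
      fin_cases i <;>
        simp [contractionMatrix_apply, Matrix.mulVec, dotProduct, Fin.sum_univ_three,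
          skew3_apply, so3]
        <;> ring
  case so3_A35 =>
    refine key (fun ε => ![0, 0, ε ^ 2]) (fun ε => ![0, -1, 0]) (fun ε => ![1, 0, 0])
      (fun i => by fin_cases i <;> simp <;> fun_prop)
      (fun i => by fin_cases i <;> simp <;> fun_prop)
      (fun i => by fin_cases i <;> simp <;> fun_prop) (fun x y i => ?_) fun ε hε x y => ?_
    · fin_cases i <;> simp [A35, skew3_apply]
    · ext i
      fin_cases i <;>
        simp [contractionMatrix_apply, Matrix.mulVec, dotProduct, Fin.sum_univ_three,
          skew3_apply, so3]
        <;> ring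

end Listed

/-! ### Associated subalgebras of the listed contractions -/

namespace Listed

variable {g g₀ : LieBracket R3} {I : Matrix (Fin 3) (Fin 3) ℝ} {k : Fin 3 → ℤ}
  {S : Option (Submodule ℝ R3)}

theorem bracket_mem {h : Submodule ℝ R3} (hl : Listed g g₀ I k (some h)) :
    ∀ x ∈ h, ∀ y ∈ h, g.bracket x y ∈ h := by
  have h1 : ∀ (μ : LieBracket R3) (v : R3), ∀ x ∈ Submodule.span ℝ {v},
      ∀ y ∈ Submodule.span ℝ {v}, μ.bracket x y ∈ Submodule.span ℝ {v} := by
    intro μ v x hx y hy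
    obtain ⟨a, rfl⟩ := Submodule.mem_span_singleton.1 hx
    obtain ⟨b, rfl⟩ := Submodule.mem_span_singleton.1 hy
    simp [μ.bracket_self]
  have h2 : ∀ (μ : LieBracket R3) (v w : R3) (a b : ℝ), μ.bracket v w = a • v + b • w →
      ∀ x ∈ Submodule.span ℝ {v, w}, ∀ y ∈ Submodule.span ℝ {v, w},
        μ.bracket x y ∈ Submodule.span ℝ {v, w} := by
    intro μ v w a b hvw x hx y hy
    obtain ⟨x₁, x₂, rfl⟩ := Submodule.mem_span_pair.1 hx
    obtain ⟨y₁, y₂, rfl⟩ := Submodule.mem_span_pair.1 hy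
    refine Submodule.mem_span_pair.2 ⟨(x₁ * y₂ - x₂ * y₁) * a, (x₁ * y₂ - x₂ * y₁) * b, ?_⟩
    simp only [map_add, map_smul, LinearMap.add_apply, LinearMap.smul_apply, μ.bracket_self,
      μ.bracket_skew w v, hvw]
    module
  cases hl with
  | A32_A33 =>
    refine h2 _ _ _ 1 0 ?_
    ext i; fin_cases i <;> simp [A32, skew3_apply]
  | sl2_A34 =>
    refine h2 _ _ _ 0 1 ?_
    ext i; fin_cases i <;> simp [sl2, skew3_apply]
  | _ => exact h1 _ _

theorem isSimpleIWAlong {h : Submodule ℝ R3} (hl : Listed g g₀ I k (some h)) {C : Contraction R3}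
    (hU : ∀ ε ∈ Ioc (0 : ℝ) 1, ∀ x : R3, C.U ε x = (contractionMatrix I k ε).mulVec x) :
    C.IsSimpleIWAlong h := by
  have hI := hl.det_ne_zero
  -- One exponent vanishes, in column j, which is swapped to the front; that column may be a
  -- multiple of the listed generator.
  have h1 : ∀ (j : Fin 3) (v : R3) (c : ℝ), c ≠ 0 → I.col j = c • v →
      (∀ i, k (Equiv.swap 0 j i) = if (i : ℕ) < 1 then 0 else 1) →
      C.IsSimpleIWAlong (Submodule.span ℝ {v}) := by
    intro j v c hc hv hk
    have := isSimpleIWAlong_of_matrix hI hU (Equiv.swap 0 j) 1 (by simpa using hk)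
    convert this using 1
    have : {x | ∃ i : Fin 3, (i : ℕ) < 1 ∧ x = I.col ((Equiv.swap 0 j).symm i)} = {c • v} := by
      ext x
      simp [hv]
    rw [this, Submodule.span_singleton_smul_eq (isUnit_iff_ne_zero.2 hc)]
  -- Two exponents vanish, and column j, the one with exponent 1, is swapped to the end.
  have h2 : ∀ (j : Fin 3) (v w : R3), I.col (Equiv.swap j 2 0) ∈ Submodule.span ℝ {v, w} →
      I.col (Equiv.swap j 2 1) ∈ Submodule.span ℝ {v, w} →
      v ∈ Submodule.span ℝ {I.col (Equiv.swap j 2 0), I.col (Equiv.swap j 2 1)} →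
      w ∈ Submodule.span ℝ {I.col (Equiv.swap j 2 0), I.col (Equiv.swap j 2 1)} →
      (∀ i, k (Equiv.swap j 2 i) = if (i : ℕ) < 2 then 0 else 1) →
      C.IsSimpleIWAlong (Submodule.span ℝ {v, w}) := by
    intro j v w h₁ h₂ h₃ h₄ hk
    have := isSimpleIWAlong_of_matrix hI hU (Equiv.swap j 2) 2 (by simpa using hk)
    convert this using 1
    have : {x | ∃ i : Fin 3, (i : ℕ) < 2 ∧ x = I.col ((Equiv.swap j 2).symm i)}
        = {I.col (Equiv.swap j 2 0), I.col (Equiv.swap j 2 1)} := by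
      ext x
      simp [Fin.exists_fin_succ]
    rw [this]
    apply le_antisymm <;> rw [Submodule.span_le] <;> rintro x (rfl | rfl) <;> assumption
  have hs1 : Equiv.swap (1 : Fin 3) 2 0 = 0 := by decide
  have hs2 : Equiv.swap (0 : Fin 3) 2 1 = 1 := by decide
  have hs3 : Equiv.swap (0 : Fin 3) 1 2 = 2 := by decide
  cases hl with
  | A21A1_A31 =>
    refine h1 2 _ (-1) (by norm_num) ?_ ?_
    · ext i; fin_cases i <;> simp [Matrix.col]
    · intro i; fin_cases i <;> simp [hs2]
  | sl2_A31 | so3_A35 =>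
    refine h1 2 _ 1 one_ne_zero ?_ ?_
    · ext i; fin_cases i <;> simp [Matrix.col]
    · intro i; fin_cases i <;> simp [hs2]
  | A32_A31 | A34_A31 | A35_A31 =>
    refine h1 1 _ 1 one_ne_zero ?_ ?_
    · ext i; fin_cases i <;> simp [Matrix.col]
    · intro i; fin_cases i <;> simp [hs3]
  | sl2_A35 =>
    refine h1 2 _ (1 / 2) (by norm_num) ?_ ?_
    · ext i; fin_cases i <;> simp [Matrix.col]
    · intro i; fin_cases i <;> simp [hs2]
  | A32_A33 =>
    refine h2 1 _ _ ?_ ?_ ?_ ?_ ?_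
    · refine Submodule.mem_span_pair.2 ⟨1, 0, ?_⟩
      ext i; fin_cases i <;> simp [hs1, Matrix.col]
    · refine Submodule.mem_span_pair.2 ⟨0, 1, ?_⟩
      ext i; fin_cases i <;> simp [Matrix.col]
    · refine Submodule.mem_span_pair.2 ⟨1, 0, ?_⟩
      ext i; fin_cases i <;> simp [hs1, Matrix.col]
    · refine Submodule.mem_span_pair.2 ⟨0, 1, ?_⟩
      ext i; fin_cases i <;> simp [Matrix.col]
    · intro i; fin_cases i <;> simp [hs1]
  | sl2_A34 =>
    refine h2 0 _ _ ?_ ?_ ?_ ?_ ?_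
    · refine Submodule.mem_span_pair.2 ⟨1, 0, ?_⟩
      ext i; fin_cases i <;> simp [Matrix.col]
    · refine Submodule.mem_span_pair.2 ⟨0, -1, ?_⟩
      ext i; fin_cases i <;> simp [hs2, Matrix.col]
    · refine Submodule.mem_span_pair.2 ⟨1, 0, ?_⟩
      ext i; fin_cases i <;> simp [Matrix.col]
    · refine Submodule.mem_span_pair.2 ⟨0, -1, ?_⟩
      ext i; fin_cases i <;> simp [hs2, Matrix.col]
    · intro i; fin_cases i <;> simp [hs2]

theorem exists_some_or (hl : Listed g g₀ I k S) :
    (∃ I' k' h, Listed g g₀ I' k' (some h)) ∨ (g = so3 ∧ g₀ = A31) := by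
  cases hl
  case A32_A31_diag => exact .inl ⟨_, _, _, .A32_A31⟩
  case A32_A33_diag => exact .inl ⟨_, _, _, .A32_A33⟩
  case so3_A31 => exact .inr ⟨rfl, rfl⟩
  all_goals exact .inl ⟨_, _, _, by constructor <;> assumption⟩

theorem isGeneralizedIW (hl : Listed g g₀ I k S) {C : Contraction R3}
    (hU : ∀ ε ∈ Ioc (0 : ℝ) 1, ∀ x : R3, C.U ε x = (contractionMatrix I k ε).mulVec x) :
    C.IsGeneralizedIW k :=
  ⟨_, _, isDiagonalized_of_matrix hl.det_ne_zero hU (Equiv.refl _)⟩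

end Listed

/-! ### Assembly, and the exceptional contraction so(3) → A_{3.1} -/

namespace Contraction

variable {V : Type*} [NormedAddCommGroup V] [NormedSpace ℝ V]

theorem isListed (hV : Module.finrank ℝ V = 3) (C : Contraction V) (hp : C.IsProper)
    (hn : C.IsNontrivial) :
    ∃ g g₀ I k S, Listed g g₀ I k S ∧ C.source.Isomorphic g ∧ C.target.Isomorphic g₀ := by
  obtain ⟨g, hg, hi⟩ := LieBracket.exists_canonical hV C.source
  obtain ⟨g₀, hg₀, hi₀⟩ := LieBracket.exists_canonical hV C.target
  obtain ⟨e, he⟩ := LieBracket.isomorphic_iff.1 hi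
  obtain ⟨f, hf⟩ := LieBracket.isomorphic_iff.1 hi₀
  have hd : LieBracket.Degenerates g g₀ := ⟨_, C.degenerates e he f hf⟩
  obtain ⟨g', g₀', I, k, S, hl, h, h₀⟩ := hd.isListed hg hg₀ (by
    rintro rfl
    exact hp (hi.trans hi₀.symm)) (by
    rintro rfl
    refine hn ((LieBracket.isLieAbelian_iff _).2 fun x y => ?_)
    apply f.injective
    simp [hf, LieBracket.abelian3])
  exact ⟨g', g₀', I, k, S, hl, hi.trans h, hi₀.trans h₀⟩

theorem isSimpleIW_const (hV : Module.finrank ℝ V = 3) (μ : LieBracket V) :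
    (const μ).IsSimpleIW := by
  have : FiniteDimensional ℝ V := Module.finite_of_finrank_eq_succ hV
  let b := Module.finBasisOfFinrankEq ℝ V hV
  -- The first block is everything and v = 0, so U is the identity.
  refine ⟨_, 3, 3, 0, b, b, fun ε hε i => ?_, rfl⟩
  simpa using const_isDiagonalized μ b ε hε i

theorem isSimpleIW_trivial (hV : Module.finrank ℝ V = 3) (μ : LieBracket V) {ν : LieBracket V}
    (hν : ∀ x y, ν.bracket x y = 0) : (trivial μ hν).IsSimpleIW := by
  have : FiniteDimensional ℝ V := Module.finite_of_finrank_eq_succ hV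
  let b := Module.finBasisOfFinrankEq ℝ V hV
  -- The first block is empty, so U = ε · id.
  refine ⟨_, 3, 0, 0, b, b, fun ε hε i => ?_, rfl⟩
  simpa using trivial_isDiagonalized μ hν b ε hε i

theorem exists_isGeneralizedIW (hV : Module.finrank ℝ V = 3) (C : Contraction V) :
    ∃ D : Contraction V, C.Equivalent D ∧
      ∃ α : Fin 3 → ℤ, (∀ i, 0 ≤ α i) ∧ D.IsGeneralizedIW α := by
  have : FiniteDimensional ℝ V := Module.finite_of_finrank_eq_succ hV
  let b := Module.finBasisOfFinrankEq ℝ V hV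
  by_cases hp : C.IsProper
  · by_cases hn : C.IsNontrivial
    · obtain ⟨g, g₀, I, k, S, hl, hi, hi₀⟩ := C.isListed hV hp hn
      obtain ⟨D, rfl, rfl, hU⟩ := hl.exists_contraction
      let e := b.equivFun.toContinuousLinearEquiv
      exact ⟨D.transport e, ⟨hi.trans (D.transport_source_isomorphic e).symm,
        hi₀.trans (D.transport_target_isomorphic e).symm⟩, k, hl.nonneg,
        transport_isGeneralizedIW e (hl.isGeneralizedIW hU)⟩
    · have h := (LieBracket.isLieAbelian_iff _).1 (not_not.1 hn)
      refine ⟨trivial C.source h, ⟨.refl _, .refl _⟩, fun _ => 1, fun _ => zero_le_one, b, b, ?_⟩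
      simpa using trivial_isDiagonalized C.source h b
  · refine ⟨const C.source, ⟨.refl _, (not_not.1 hp).symm⟩, fun _ => 0, fun _ => le_rfl, b, b, ?_⟩
    simpa using const_isDiagonalized C.source b

theorem exists_isSimpleIW_or (hV : Module.finrank ℝ V = 3) (C : Contraction V) :
    (∃ D : Contraction V, C.Equivalent D ∧ D.IsSimpleIW) ∨
      (C.source.Isomorphic so3 ∧ C.target.Isomorphic A31) := by
  have : FiniteDimensional ℝ V := Module.finite_of_finrank_eq_succ hV
  by_cases hp : C.IsProper
  · by_cases hn : C.IsNontrivial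
    · obtain ⟨g, g₀, I, k, S, hl, hi, hi₀⟩ := C.isListed hV hp hn
      rcases hl.exists_some_or with ⟨I', k', h, hl'⟩ | ⟨rfl, rfl⟩
      · obtain ⟨D, rfl, rfl, hU⟩ := hl'.exists_contraction
        let e := (Module.finBasisOfFinrankEq ℝ V hV).equivFun.toContinuousLinearEquiv
        exact .inl ⟨D.transport e, ⟨hi.trans (D.transport_source_isomorphic e).symm,
          hi₀.trans (D.transport_target_isomorphic e).symm⟩,
          transport_isSimpleIW e ⟨_, hl'.isSimpleIWAlong hU⟩⟩
      · exact .inr ⟨hi, hi₀⟩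
    · have h := (LieBracket.isLieAbelian_iff _).1 (not_not.1 hn)
      exact .inl ⟨trivial C.source h, ⟨.refl _, .refl _⟩, isSimpleIW_trivial hV _ h⟩
  · exact .inl ⟨const C.source, ⟨.refl _, (not_not.1 hp).symm⟩, isSimpleIW_const hV _⟩

/-- If every vector of a basis belongs to the second block, then the contraction is trivial. -/
theorem target_eq_zero_of_isDiagonalized (C : Contraction V) {n : ℕ}
    {b b' : Module.Basis (Fin n) ℝ V} (h : C.IsDiagonalized b b' fun ε _ => ε) (x y : V) :
    C.target.bracket x y = 0 := by
  have : FiniteDimensional ℝ V := b.finiteDimensional_of_finite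
  let L : V ≃L[ℝ] V := (b'.equiv b (Equiv.refl _)).toContinuousLinearEquiv
  have hL : ∀ ε ∈ Ioc (0 : ℝ) 1, ∀ z, C.U ε z = ε • L z := by
    intro ε hε z
    have : (C.U ε).toLinearEquiv.toLinearMap = ε • L.toLinearEquiv.toLinearMap :=
      b'.ext fun i => by simpa [L] using h ε hε i
    exact LinearMap.congr_fun this z
  have ht : Tendsto (fun ε : ℝ => ε • L.symm (C.source.bracket (L x) (L y))) (𝓝[>] 0)
      (𝓝 ((0 : ℝ) • L.symm (C.source.bracket (L x) (L y)))) :=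
    tendsto_nhdsWithin_of_tendsto_nhds (tendsto_id.smul_const _)
  rw [zero_smul] at ht
  refine tendsto_nhds_unique (C.tendsto x y) (ht.congr' ?_)
  filter_upwards [Ioc_mem_nhdsGT zero_lt_one] with ε hε
  rw [ContinuousLinearEquiv.eq_symm_apply, hL ε hε, hL ε hε, hL ε hε]
  simp

/-- For i in the first block, U b'ᵢ = (1 + εv) bᵢ, so the transformed Killing form at b'ᵢ tends to
that of so(3) at bᵢ, which is negative. The limit should be 0, since the Killing form of the
two-step nilpotent target vanishes. -/
theorem not_isSimpleIW (C : Contraction V) (hs : C.source.Isomorphic so3)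
    (ht : C.target.Isomorphic A31) : ¬ C.IsSimpleIW := by
  rintro ⟨S, n, s, v, b, b', hd, -⟩
  obtain ⟨e, he⟩ := LieBracket.isomorphic_iff.1 hs
  obtain ⟨f, hf⟩ := LieBracket.isomorphic_iff.1 ht
  have hlim := C.degenerates e he f hf
  by_cases hi : ∃ i : Fin n, (i : ℕ) < s
  · obtain ⟨i, hi⟩ := hi
    have hk := LieBracket.tendsto_killing hlim (f (b' i)) (f (b' i))
    have h0 : LieBracket.killing A31 (f (b' i)) (f (b' i)) = 0 := by
      rw [LieBracket.killing_eq]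
      simp [LieBracket.A31_two_step_nilpotent]
    rw [h0] at hk
    have hc : Tendsto (fun ε : ℝ => (1 + ε * v) ^ 2 * LieBracket.killing so3 (e (b i)) (e (b i)))
        (𝓝[>] 0) (𝓝 ((1 + 0 * v) ^ 2 * LieBracket.killing so3 (e (b i)) (e (b i)))) :=
      tendsto_nhdsWithin_of_tendsto_nhds (Continuous.tendsto (by fun_prop) 0)
    have h1 := tendsto_nhds_unique hk (hc.congr' (by
      filter_upwards [Ioc_mem_nhdsGT zero_lt_one] with ε hε
      have := hd ε hε i
      simp only [hi, if_true] at this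
      rw [LieBracket.killing_pullback]
      simp [this, LieBracket.killing_so3]
      ring))
    rw [LieBracket.killing_so3] at h1
    have hz : e (b i) ≠ 0 := by simpa using b.ne_zero i
    apply hz
    have h00 := sq_nonneg (e (b i) 0)
    have h11 := sq_nonneg (e (b i) 1)
    have h22 := sq_nonneg (e (b i) 2)
    ext j
    fin_cases j <;> refine pow_eq_zero_iff two_ne_zero |>.1 (le_antisymm ?_ (sq_nonneg _)) <;>
      simp only [Fin.zero_eta, Fin.mk_one, Fin.reduceFinMk] <;> linarith
  · push Not at hi
    have h0 := C.target_eq_zero_of_isDiagonalized (b := b) (b' := b') fun ε hε i => by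
      simpa [not_lt.2 (hi i)] using hd ε hε i
    have := hf (f.symm ![0, 1, 0]) (f.symm ![0, 0, 1])
    rw [h0, map_zero, f.apply_symm_apply, f.apply_symm_apply] at this
    have := congrFun this 0
    simp [A31, skew3_apply] at this

end Contraction

theorem mainTheorem2 {V : Type*} [NormedAddCommGroup V] [NormedSpace ℝ V]
    (hV : Module.finrank ℝ V = 3) :
    -- every contraction is equivalent to a generalized IW-contraction with nonnegative powers
    (∀ C : Contraction V, ∃ D : Contraction V, C.Equivalent D ∧
      ∃ α : Fin 3 → ℤ, (∀ i, 0 ≤ α i) ∧ D.IsGeneralizedIW α) ∧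
    -- the list is complete
    (∀ C : Contraction V, C.IsProper → C.IsNontrivial →
      ∃ g g₀ I k S, Listed g g₀ I k S ∧
        C.source.Isomorphic g ∧ C.target.Isomorphic g₀) ∧
    -- all members of the list are proper nontrivial contractions, with the listed data
    (∀ g g₀ I k S, Listed g g₀ I k S →
      ∃ C : Contraction R3, C.source = g ∧ C.target = g₀ ∧
        (∀ ε ∈ Set.Ioc (0 : ℝ) 1, ∀ x : R3,
          C.U ε x = (I * Matrix.diagonal (fun i => ε ^ k i)).mulVec x) ∧
        C.IsProper ∧ C.IsNontrivial ∧
        (∀ h, S = some h → (∀ x ∈ h, ∀ y ∈ h, g.bracket x y ∈ h) ∧ C.IsSimpleIWAlong h)) ∧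
    -- exactly the contraction from so(3) to A_{3.1} is inequivalent to a simple IW-contraction
    (∀ C : Contraction V,
      (¬ ∃ D : Contraction V, C.Equivalent D ∧ D.IsSimpleIW) ↔
        (C.source.Isomorphic so3 ∧ C.target.Isomorphic A31)) := by
  refine ⟨fun C => C.exists_isGeneralizedIW hV, fun C => C.isListed hV, fun g g₀ I k S hl => ?_,
    fun C => ⟨(C.exists_isSimpleIW_or hV).resolve_left, ?_⟩⟩
  · obtain ⟨C, rfl, rfl, hU⟩ := hl.exists_contraction
    refine ⟨C, rfl, rfl, hU, hl.not_isomorphic,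
      fun hab => hl.not_abelian ((LieBracket.isLieAbelian_iff _).1 hab _ _), ?_⟩
    rintro h rfl
    exact ⟨hl.bracket_mem, hl.isSimpleIWAlong hU⟩
  · rintro ⟨hs, ht⟩ ⟨D, ⟨hs', ht'⟩, hD⟩
    exact D.not_isSimpleIW (hs'.symm.trans hs) (ht'.symm.trans ht) hD
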